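/- Let $(\Omega,\mathcal F,\mathbb P)$ be a nonatomic probability space and $L^0$ the space of real random variables on it, modulo a.s. equality and with the a.s. order. Let $\Phi:[0,\infty)\to[0,\infty)$ be an Orlicz function, i.e. non-constant, convex and increasing (not necessarily strictly) with $\Phi(0)=0$, and let $$H^\Phi=\{X\in L^0:\ \mathbb E[\Phi(\lambda|X|)]<\infty\ \text{ for every }\lambda>0\}$$ be its Orlicz heart. Let $\rho:H^\Phi\to\mathbb R$ be a functional that is convex, law-invariant ($\rho(X)=\rho(Y)$ whenever $X$ and $Y$ have the same distribution) and order bounded above (for all $U\le V$ in $H^\Phi$, $\rho$ is bounded above on $\{X\in H^\Phi: U\le X\le V\}$). Denote by $\mathcal R_\rho$ the induced map on distributions, $\mathcal R_\rho(\mathbb P\circ X^{-1})=\rho(X)$ for $X\in H^\Phi$. Then $\rho$ is strongly consistent at every $X\in H^\Phi$. That is, let $X\in H^\Phi$ and let $(X_n)_{n\ge1}$ be any stationary ergodic sequence of random variables on $\Omega$, each with the distribution of $X$. Then for every $n\geq 1$ and $\omega\in\Omega$ the empirical distribution $\widehat m_n(\omega)=\frac1n\sum_{i=1}^n\delta_{X_i(\omega)}$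 is the distribution of some element of $H^\Phi$, and $$\mathcal R_\rho(\widehat m_n)\longrightarrow\rho(X)\quad\text{a.s. as } n\to\infty .$$ Here $(X_n)$ is stationary if $\mathbb P(X_1\le x_1,\dots,X_n\le x_n)=\mathbb P(X_{k+1}\le x_1,\dots,X_{k+n}\le x_n)$ for all $k,n$ and all $x_1,\dots,x_n\in\mathbb R$. A stationary sequence is ergodic if every invariant event has probability $0$ or $1$, where $A\in\mathcal F$ is invariant if there is a Borel set $B\subseteq\mathbb R^{\mathbb N}$ with $A=\{(X_n)_{n\ge k}\in B\}$ for every $k\geq 1$. -/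

import Mathlib

open MeasureTheory Filter Topology
open scoped NNReal ENNReal

/-- Orlicz functions `Φ : [0,∞) → [0,∞)`: non-constant, convex, increasing (in the weak sense),
with `Φ 0 = 0`. -/
structure IsOrliczFunction (Φ : ℝ≥0 → ℝ≥0) : Prop where
  nonconstant : ∃ x y, Φ x ≠ Φ y
  convex : ConvexOn ℝ≥0 Set.univ Φ
  increasing : Monotone Φ
  map_zero : Φ 0 = 0

section OrliczHeart

variable {Ω : Type*} [MeasurableSpace Ω]

/-- A nonatomic measure: every measurable set of positive measure contains a measurable subset of
strictly smaller, positive measure. (Mathlib's `NoAtoms` only says that points are null.) -/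
def IsNonatomic (P : Measure Ω) : Prop :=
  ∀ A, MeasurableSet A → 0 < P A → ∃ B ⊆ A, MeasurableSet B ∧ 0 < P B ∧ P B < P A

/-- The Orlicz heart: all `X ∈ L⁰` such that `𝔼[Φ(c|X|)] < ∞` for every `c > 0`,
as a linear subspace of `L⁰`. Its order is the almost sure order inherited from `L⁰`. -/
noncomputable def orliczHeart {Φ : ℝ≥0 → ℝ≥0} (hΦ : IsOrliczFunction Φ) (P : Measure Ω) :
    Submodule ℝ (Ω →ₘ[P] ℝ) where
  carrier := {X | ∀ c : ℝ≥0, 0 < c → ∫⁻ ω, (Φ (c * ‖X ω‖₊) : ℝ≥0∞) ∂P < ∞}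
  zero_mem' := by
    intro c _
    have h : (fun ω => (Φ (c * ‖(0 : Ω →ₘ[P] ℝ) ω‖₊) : ℝ≥0∞)) =ᵐ[P] fun _ => 0 := by
      filter_upwards [AEEqFun.coeFn_zero (α := Ω) (β := ℝ) (μ := P)] with ω hω
      simp [hω, hΦ.map_zero]
    rw [lintegral_congr_ae h]
    simp
  add_mem' := by
    intro X Y hX hY c hc
    have key : ∀ᵐ ω ∂P, (Φ (c * ‖(X + Y) ω‖₊) : ℝ≥0∞) ≤
        (Φ ((2 * c) * ‖X ω‖₊) : ℝ≥0∞) + (Φ ((2 * c) * ‖Y ω‖₊) : ℝ≥0∞) := by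
      filter_upwards [AEEqFun.coeFn_add X Y] with ω hω
      rw [hω, Pi.add_apply, ← ENNReal.coe_add, ENNReal.coe_le_coe]
      have h2 : (2⁻¹ : ℝ≥0) + 2⁻¹ = 1 := by
        rw [← two_mul]
        exact mul_inv_cancel₀ two_ne_zero
      have hconv := hΦ.convex.2 (Set.mem_univ ((2 * c) * ‖X ω‖₊))
        (Set.mem_univ ((2 * c) * ‖Y ω‖₊)) (zero_le (a := (2⁻¹ : ℝ≥0)))
        (zero_le (a := (2⁻¹ : ℝ≥0))) h2
      simp only [smul_eq_mul] at hconv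
      have harg : (2⁻¹ : ℝ≥0) * (2 * c * ‖X ω‖₊) + 2⁻¹ * (2 * c * ‖Y ω‖₊)
          = c * (‖X ω‖₊ + ‖Y ω‖₊) := by
        field_simp
      rw [harg] at hconv
      have hle : (2⁻¹ : ℝ≥0) ≤ 1 := h2 ▸ le_self_add
      calc Φ (c * ‖X ω + Y ω‖₊) ≤ Φ (c * (‖X ω‖₊ + ‖Y ω‖₊)) :=
            hΦ.increasing (mul_le_mul_right (nnnorm_add_le _ _) c)
        _ ≤ _ := hconv
        _ ≤ _ := add_le_add (mul_le_of_le_one_left' hle) (mul_le_of_le_one_left' hle)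
    refine (lintegral_mono_ae key).trans_lt ?_
    have hm : Measurable fun ω => (Φ ((2 * c) * ‖X ω‖₊) : ℝ≥0∞) :=
      (hΦ.increasing.measurable.comp
        ((X.stronglyMeasurable.measurable.nnnorm).const_mul (2 * c))).coe_nnreal_ennreal
    rw [lintegral_add_left hm]
    have hc2 : 0 < 2 * c := mul_pos two_pos hc
    exact ENNReal.add_lt_top.2 ⟨hX _ hc2, hY _ hc2⟩
  smul_mem' := by
    intro a X hX c hc
    have key : (fun ω => (Φ (c * ‖(a • X) ω‖₊) : ℝ≥0∞)) =ᵐ[P]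
        fun ω => (Φ ((c * ‖a‖₊) * ‖X ω‖₊) : ℝ≥0∞) := by
      filter_upwards [AEEqFun.coeFn_smul a X] with ω hω
      rw [hω, Pi.smul_apply, smul_eq_mul, nnnorm_mul, mul_assoc]
    rw [lintegral_congr_ae key]
    by_cases ha : a = 0
    · simp [ha, hΦ.map_zero]
    · exact hX _ (mul_pos hc (nnnorm_pos.2 ha))

end OrliczHeart

/-- A functional is order bounded above if it is bounded above on every order interval. -/
def OrderBoundedAbove {E : Type*} [Preorder E] (ρ : E → ℝ) : Prop :=
  ∀ U V : E, U ≤ V → BddAbove (ρ '' Set.Icc U V)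

section LawInvariance

variable {Ω : Type*} [MeasurableSpace Ω] {P : Measure Ω} {𝒳 : Submodule ℝ (Ω →ₘ[P] ℝ)}

/-- The distribution of an element of `L⁰`. -/
noncomputable def lawOf (X : Ω →ₘ[P] ℝ) : Measure ℝ := P.map (X : Ω → ℝ)

/-- The set of the distributions of the elements of `𝒳`. -/
def lawsOf (𝒳 : Submodule ℝ (Ω →ₘ[P] ℝ)) : Set (Measure ℝ) :=
  {ν | ∃ X : 𝒳, lawOf (X : Ω →ₘ[P] ℝ) = ν}

/-- `ρ X = ρ Y` whenever `X` and `Y` have the same distribution. -/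
def LawInvariant (ρ : 𝒳 → ℝ) : Prop :=
  ∀ X Y : 𝒳, lawOf (X : Ω →ₘ[P] ℝ) = lawOf (Y : Ω →ₘ[P] ℝ) → ρ X = ρ Y

/-- The map induced by `ρ` on the distributions of the elements of `𝒳`: the value at `ν` is `ρ X`
for some `X ∈ 𝒳` with distribution `ν`; for a law-invariant `ρ` the choice of `X` is irrelevant. -/
noncomputable def inducedMap (ρ : 𝒳 → ℝ) (ν : lawsOf 𝒳) : ℝ := ρ ν.2.choose

theorem LawInvariant.inducedMap_lawOf {ρ : 𝒳 → ℝ} (hρ : LawInvariant ρ) (X : 𝒳) :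
    inducedMap ρ ⟨lawOf (X : Ω →ₘ[P] ℝ), X, rfl⟩ = ρ X :=
  hρ _ _ (Exists.choose_spec (p := fun Y : 𝒳 => lawOf (Y : Ω →ₘ[P] ℝ) = lawOf (X : Ω →ₘ[P] ℝ))
    ⟨X, rfl⟩)

end LawInvariance

section StrongConsistency

variable {Ω : Type*} [MeasurableSpace Ω]

/-- Stationarity of a sequence of random variables (indexed from `0`), through the joint
distribution functions. -/
def IsStationarySeq (P : Measure Ω) (ξ : ℕ → Ω → ℝ) : Prop :=
  ∀ (k n : ℕ) (x : Fin n → ℝ),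
    P {ω | ∀ i : Fin n, ξ i ω ≤ x i} = P {ω | ∀ i : Fin n, ξ (k + i) ω ≤ x i}

/-- An event `A` is invariant for the sequence `ξ` if there is a Borel set `B` of real sequences
such that `A = {(ξ k, ξ (k + 1), …) ∈ B}` for every `k`. -/
def IsInvariantEvent (ξ : ℕ → Ω → ℝ) (A : Set Ω) : Prop :=
  MeasurableSet A ∧ ∃ B : Set (ℕ → ℝ), MeasurableSet B ∧
    ∀ k : ℕ, A = {ω | (fun n => ξ (k + n) ω) ∈ B}

/-- Every invariant event has probability zero or one. -/
def IsErgodicSeq (P : Measure Ω) (ξ : ℕ → Ω → ℝ) : Prop :=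
  ∀ A, IsInvariantEvent ξ A → P A = 0 ∨ P A = 1

/-- The empirical distribution of the first `n` terms at `ω` (meaningful for `n ≥ 1`). -/
noncomputable def empiricalMeasure (ξ : ℕ → Ω → ℝ) (n : ℕ) (ω : Ω) : Measure ℝ :=
  (n : ℝ≥0∞)⁻¹ • ∑ i ∈ Finset.range n, Measure.dirac (ξ i ω)

variable {P : Measure Ω} {𝒳 : Submodule ℝ (Ω →ₘ[P] ℝ)}

/-- `ρ` is strongly consistent at `X` if, for every stationary ergodic sequence of random variables
with the distribution of `X`, the empirical distributions of the first `n + 1` terms are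
distributions of elements of `𝒳`, so that the map induced by `ρ` can be evaluated at them, and the
resulting empirical estimates converge almost surely to `ρ X`. -/
def StronglyConsistentAt (ρ : 𝒳 → ℝ) (X : 𝒳) : Prop :=
  ∀ ξ : ℕ → Ω → ℝ, (∀ n, Measurable (ξ n)) → IsStationarySeq P ξ → IsErgodicSeq P ξ →
    (∀ n, P.map (ξ n) = lawOf (X : Ω →ₘ[P] ℝ)) →
    ∃ hmem : ∀ n ω, empiricalMeasure ξ (n + 1) ω ∈ lawsOf 𝒳,
      ∀ᵐ ω ∂P, Tendsto (fun n => inducedMap ρ ⟨empiricalMeasure ξ (n + 1) ω, hmem n ω⟩)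
        atTop (𝓝 (ρ X))

end StrongConsistency

/-! The probability and the analysis separate. For a stationary ergodic sequence, Birkhoff's theorem
for the shift on real sequences gives, for almost every ω, convergence of the empirical distribution
functions at all rationals and of the empirical modulars `∫ Φ(2(k+1)|x|)` for all naturals `k`.
These are countably many statements, so one null set is discarded; then ω is fixed and the rest is
deterministic.

Law invariance permits evaluating `ρ` on convenient representatives. A nonatomic space carries a
uniform variable `U`, and composing quantile functions with the same `U` realizes the empirical laws
and the law of `X` as elements `Y_n` and `Z` of the heart with `Y_n → Z` almost surely. Together
with the convergence of the modulars, dominated convergence with varying bounds gives `𝔼 Φ((k+1)|Y_n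
- Z|) → 0` for every `k` (`IsOrliczFunction.tendsto_modular_sub`).

Finally, `ρ` is continuous for this mode of convergence (`ConvexOn.tendsto_of_tendsto_modular`).
From any subsequence one selects terms `Y_k` whose modulars decay so fast that `sup_k (k+1)|Y_k -
Z|` stays in the heart. Then all `Z ± (k+1)(Y_k - Z)` lie in one order interval, on which `ρ` is
bounded above, and convexity on the line through `Z` and `Y_k` forces `|ρ(Y_k) - ρ(Z)| = O(1/k)`. -/

/-! ### Birkhoff's pointwise ergodic theorem -/

section Birkhoff

variable {α : Type*} {T : α → α} {f : α → ℝ}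

/-- The running maximum of the Birkhoff sums of orders `1, …, n + 1`. -/
def maxBirkhoffSum (T : α → α) (f : α → ℝ) : ℕ → α → ℝ
  | 0 => f
  | n + 1 => fun x => f x + max 0 (maxBirkhoffSum T f n (T x))

theorem maxBirkhoffSum_le_succ (n : ℕ) :
    ∀ x, maxBirkhoffSum T f n x ≤ maxBirkhoffSum T f (n + 1) x := by
  induction n with
  | zero => intro x; simp [maxBirkhoffSum]
  | succ n ih =>
    intro x
    have := ih (T x)
    simp only [maxBirkhoffSum] at this ⊢
    gcongr

theorem monotone_maxBirkhoffSum (x : α) : Monotone fun n => maxBirkhoffSum T f n x :=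
  monotone_nat_of_le_succ fun n => maxBirkhoffSum_le_succ n x

theorem birkhoffSum_succ_le_maxBirkhoffSum (n : ℕ) :
    ∀ x, birkhoffSum T f (n + 1) x ≤ maxBirkhoffSum T f n x := by
  induction n with
  | zero => intro x; simp [maxBirkhoffSum]
  | succ n ih =>
    intro x
    rw [birkhoffSum_succ']
    simp only [maxBirkhoffSum]
    gcongr
    exact (ih _).trans (le_max_right _ _)

variable [MeasurableSpace α] {μ : Measure α}

theorem measurable_maxBirkhoffSum (hT : Measurable T) (hf : Measurable f) (n : ℕ) :
    Measurable (maxBirkhoffSum T f n) := by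
  induction n with
  | zero => exact hf
  | succ n ih => exact hf.add (measurable_const.max (ih.comp hT))

theorem integrable_maxBirkhoffSum (hT : MeasurePreserving T μ μ) (hf : Integrable f μ) (n : ℕ) :
    Integrable (maxBirkhoffSum T f n) μ := by
  induction n with
  | zero => exact hf
  | succ n ih =>
    exact hf.add ((integrable_zero _ _ _).sup (hT.integrable_comp_of_integrable ih))

theorem measurable_birkhoffSum (hT : Measurable T) (hf : Measurable f) (n : ℕ) :
    Measurable (birkhoffSum T f n) :=
  Finset.measurable_sum _ fun k _ => hf.comp (hT.iterate k)

/-- The Birkhoff sums of a function with negative mean under an ergodic map are almost surely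
bounded above. -/
theorem Ergodic.ae_bddAbove_birkhoffSum [IsProbabilityMeasure μ] (hT : Ergodic T μ)
    (hfm : Measurable f) (hf : Integrable f μ) (hneg : ∫ x, f x ∂μ < 0) :
    ∀ᵐ x ∂μ, ∃ C : ℕ, ∀ n, birkhoffSum T f n x < C := by
  set A : Set α := {x | ∀ C : ℕ, ∃ n, (C : ℝ) ≤ birkhoffSum T f n x} with hA
  have hAm : MeasurableSet A := by
    simp only [hA, Set.ofPred_forall, Set.ofPred_exists]
    exact MeasurableSet.iInter fun C => MeasurableSet.iUnion fun n =>
      measurableSet_le measurable_const (measurable_birkhoffSum hT.measurable hfm n)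
  -- Since `S_{n+1}(x) = f(x) + S_n(Tx)`, the sums at `x` and at `Tx` are unbounded above together.
  have hAinv : T ⁻¹' A = A := by
    ext x
    constructor
    · intro hx C
      obtain ⟨N, hN⟩ := exists_nat_ge (C - f x)
      obtain ⟨n, hn⟩ := hx N
      refine ⟨n + 1, ?_⟩
      rw [birkhoffSum_succ']
      linarith
    · intro hx C
      obtain ⟨N, hN⟩ := exists_nat_ge (C + f x)
      -- Asking for `N + 1` instead of `N` rules out the empty sum.
      obtain ⟨n, hn⟩ := hx (N + 1)
      push_cast at hn
      cases n with
      | zero =>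
        rw [birkhoffSum_zero] at hn
        have : (0 : ℝ) ≤ N := N.cast_nonneg
        linarith
      | succ n =>
        rw [birkhoffSum_succ'] at hn
        exact ⟨n, by linarith⟩
  rcases hT.toPreErgodic.ae_mem_or_ae_notMem hAm hAinv with h | h
  · exfalso
    -- With `M_n` the running maximum, the integrand equals `M_{n+1} - M_n ∘ T`. If the sums are
    -- almost surely unbounded, `M_n ∘ T` is eventually positive and the integrand becomes `f`. Its
    -- integral is `∫ M_{n+1} - ∫ M_n ≥ 0` by invariance of `μ`, contradicting `∫ f < 0`.
    have hlim : Tendsto (fun n => ∫ x, (f x + max (-maxBirkhoffSum T f n (T x)) 0) ∂μ) atTop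
        (𝓝 (∫ x, f x ∂μ)) := by
      have hfT : Integrable (fun x => f (T x)) μ := hT.integrable_comp_of_integrable hf
      refine tendsto_integral_of_dominated_convergence (fun x => |f x| + |f (T x)|)
        (fun n => ?_) (hf.abs.add hfT.abs) (fun n => ?_) ?_
      · exact (hfm.add (((measurable_maxBirkhoffSum hT.measurable hfm n).comp
          hT.measurable).neg.max measurable_const)).aestronglyMeasurable
      · refine ae_of_all _ fun x => ?_
        have h0 : f (T x) ≤ maxBirkhoffSum T f n (T x) :=
          monotone_maxBirkhoffSum (T x) (Nat.zero_le n)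
        refine (norm_add_le _ _).trans ?_
        rw [Real.norm_eq_abs, Real.norm_eq_abs, abs_of_nonneg (le_max_right _ (0 : ℝ))]
        gcongr
        exact max_le ((neg_le_neg h0).trans (neg_le_abs _)) (abs_nonneg _)
      · filter_upwards [h] with x hx
        rw [← hAinv] at hx
        obtain ⟨n, hn⟩ := hx 1
        cases n with
        | zero => norm_num at hn
        | succ n =>
          refine tendsto_const_nhds.congr' ?_
          filter_upwards [eventually_ge_atTop n] with m hm
          have h1 := birkhoffSum_succ_le_maxBirkhoffSum (T := T) (f := f) n (T x)
          have h2 := monotone_maxBirkhoffSum (T := T) (f := f) (T x) hm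
          simp only at h2
          push_cast at hn
          rw [max_eq_right (by linarith), add_zero]
    refine absurd (ge_of_tendsto' hlim fun n => ?_) hneg.not_ge
    have hi := integrable_maxBirkhoffSum hT.toMeasurePreserving hf
    have hiT : Integrable (fun x => maxBirkhoffSum T f n (T x)) μ :=
      hT.integrable_comp_of_integrable (hi n)
    have heq : ∫ x, (f x + max (-maxBirkhoffSum T f n (T x)) 0) ∂μ
        = ∫ x, maxBirkhoffSum T f (n + 1) x ∂μ - ∫ x, maxBirkhoffSum T f n x ∂μ := by
      have hc : ∫ x, maxBirkhoffSum T f n x ∂μ = ∫ x, maxBirkhoffSum T f n (T x) ∂μ := by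
        conv_lhs => rw [← hT.map_eq]
        exact integral_map hT.measurable.aemeasurable
          (measurable_maxBirkhoffSum hT.measurable hfm n).aestronglyMeasurable
      rw [hc, ← integral_sub (hi (n + 1)) hiT]
      refine integral_congr_ae (ae_of_all _ fun x => ?_)
      simp only [maxBirkhoffSum]
      rcases le_total 0 (maxBirkhoffSum T f n (T x)) with h | h
      · rw [max_eq_right h, max_eq_right (by linarith)]; ring
      · rw [max_eq_left h, max_eq_left (by linarith)]; ring
    rw [heq, sub_nonneg]
    exact integral_mono (hi n) (hi (n + 1)) (maxBirkhoffSum_le_succ n)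
  · filter_upwards [h] with x hx
    simpa [hA] using hx

/-- For `b` strictly between the mean and `a`, the sums of `f - b` are bounded above, and division
by `n` removes the bound. -/
theorem Ergodic.ae_eventually_birkhoffSum_div_lt [IsProbabilityMeasure μ] (hT : Ergodic T μ)
    (hfm : Measurable f) (hf : Integrable f μ) {a : ℝ} (ha : ∫ x, f x ∂μ < a) :
    ∀ᵐ x ∂μ, ∀ᶠ n : ℕ in atTop, birkhoffSum T f n x / n < a := by
  obtain ⟨b, hb, hba⟩ := exists_between ha
  have hint : ∫ x, (f x - b) ∂μ < 0 := by
    rw [integral_sub hf (integrable_const b)]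
    simpa using hb
  filter_upwards [hT.ae_bddAbove_birkhoffSum (hfm.sub_const b) (hf.sub (integrable_const b)) hint]
    with x ⟨C, hC⟩
  have hlim : Tendsto (fun n : ℕ => b + (C : ℝ) / n) atTop (𝓝 (b + 0)) :=
    tendsto_const_nhds.add (tendsto_const_div_atTop_nhds_zero_nat _)
  rw [add_zero] at hlim
  filter_upwards [hlim.eventually_lt_const hba, eventually_gt_atTop 0] with n hn hn0
  refine lt_trans ?_ hn
  have hpos : (0 : ℝ) < n := by exact_mod_cast hn0
  have h1 := hC n
  have h2 : birkhoffSum T (fun x => f x - b) n x = birkhoffSum T f n x - n * b := by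
    simp [birkhoffSum, Finset.sum_sub_distrib]
  rw [h2] at h1
  rw [div_lt_iff₀ hpos, add_mul, div_mul_cancel₀ _ hpos.ne']
  linarith

/-- Birkhoff's pointwise ergodic theorem for ergodic maps. -/
theorem Ergodic.ae_tendsto_birkhoffSum_div [IsProbabilityMeasure μ] (hT : Ergodic T μ)
    (hfm : Measurable f) (hf : Integrable f μ) :
    ∀ᵐ x ∂μ, Tendsto (fun n : ℕ => birkhoffSum T f n x / n) atTop (𝓝 (∫ x, f x ∂μ)) := by
  have hpos : ∀ m : ℕ, (0 : ℝ) < 1 / ((m : ℝ) + 1) := fun m => Nat.one_div_pos_of_nat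
  have hup := ae_all_iff.2 fun m : ℕ =>
    hT.ae_eventually_birkhoffSum_div_lt hfm hf (lt_add_of_pos_right _ (hpos m))
  have hlow := ae_all_iff.2 fun m : ℕ =>
    hT.ae_eventually_birkhoffSum_div_lt hfm.neg hf.neg (lt_add_of_pos_right _ (hpos m))
  filter_upwards [hup, hlow] with x hu hl
  refine Metric.tendsto_atTop'.2 fun ε hε => ?_
  obtain ⟨m, hm⟩ := exists_nat_one_div_lt hε
  obtain ⟨N, hN⟩ := eventually_atTop.1 ((hu m).and (hl m))
  refine ⟨N, fun n hn => ?_⟩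
  obtain ⟨h1, h2⟩ := hN n hn.le
  rw [birkhoffSum_neg, Pi.neg_def, neg_div] at h2
  simp only [integral_neg] at h2
  rw [Real.dist_eq, abs_lt]
  constructor <;> linarith

end Birkhoff

/-! ### The strong law for stationary ergodic sequences, via the shift -/

section StationarySequences

variable {Ω : Type*} [MeasurableSpace Ω]

/-- The sets of real sequences given by finitely many initial upper bounds. -/
def initialBoxes : Set (Set (ℕ → ℝ)) :=
  {S | ∃ (n : ℕ) (a : ℕ → ℝ), S = {x | ∀ i < n, x i ≤ a i}}

theorem isPiSystem_initialBoxes : IsPiSystem initialBoxes := by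
  rintro _ ⟨n, a, rfl⟩ _ ⟨m, b, rfl⟩ -
  refine ⟨max n m, fun i => if i < n then (if i < m then min (a i) (b i) else a i) else b i, ?_⟩
  ext x
  simp only [Set.mem_inter_iff, Set.mem_ofPred_eq]
  constructor
  · rintro ⟨h1, h2⟩ i hi
    split_ifs with hn hm
    · exact le_min (h1 i hn) (h2 i hm)
    · exact h1 i hn
    · exact h2 i (by omega)
  · intro h
    refine ⟨fun i hi => ?_, fun i hi => ?_⟩
    · have := h i (by omega)
      rw [if_pos hi] at this
      split_ifs at this with hm
      · exact this.trans (min_le_left _ _)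
      · exact this
    · have := h i (by omega)
      rw [if_pos hi] at this
      split_ifs at this with hm
      · exact this.trans (min_le_right _ _)
      · exact this

theorem measurableSet_initialBox (n : ℕ) (a : ℕ → ℝ) :
    MeasurableSet {x : ℕ → ℝ | ∀ i < n, x i ≤ a i} := by
  simp only [Set.ofPred_forall]
  exact MeasurableSet.iInter fun i => MeasurableSet.iInter fun _ =>
    measurableSet_le (measurable_pi_apply i) measurable_const

theorem generateFrom_initialBoxes :
    (inferInstance : MeasurableSpace (ℕ → ℝ)) = MeasurableSpace.generateFrom initialBoxes := by
  apply le_antisymm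
  · refine iSup_le fun i => ?_
    rw [← measurable_iff_comap_le]
    let : MeasurableSpace (ℕ → ℝ) := MeasurableSpace.generateFrom initialBoxes
    refine measurable_of_Iic fun a => ?_
    -- A box must also bound the coordinates before `i`; bounding them by `N` and letting `N` grow
    -- removes the constraint.
    have : (fun x : ℕ → ℝ => x i) ⁻¹' Set.Iic a
        = ⋃ N : ℕ, {x | ∀ j < i + 1, x j ≤ if j = i then a else N} := by
      ext x
      simp only [Set.mem_preimage, Set.mem_Iic, Set.mem_iUnion, Set.mem_ofPred_eq]
      constructor
      · intro hx
        obtain ⟨N, hN⟩ := exists_nat_ge (∑ j ∈ Finset.range i, |x j|)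
        refine ⟨N, fun j hj => ?_⟩
        split_ifs with h
        · exact h ▸ hx
        · exact (le_abs_self _).trans ((Finset.single_le_sum (f := fun j => |x j|)
            (fun _ _ => abs_nonneg _) (Finset.mem_range.2 (by omega))).trans hN)
      · rintro ⟨N, hN⟩
        simpa using hN i (Nat.lt_succ_self i)
    rw [this]
    exact MeasurableSet.iUnion fun N => MeasurableSpace.measurableSet_generateFrom ⟨_, _, rfl⟩
  · refine MeasurableSpace.generateFrom_le ?_
    rintro _ ⟨n, a, rfl⟩
    exact measurableSet_initialBox n a

/-- The shift on real sequences. -/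
def seqShift (x : ℕ → ℝ) : ℕ → ℝ := fun n => x (n + 1)

theorem measurable_seqShift : Measurable seqShift :=
  measurable_pi_lambda _ fun n => measurable_pi_apply (n + 1)

theorem seqShift_iterate_apply (k : ℕ) (x : ℕ → ℝ) (n : ℕ) : seqShift^[k] x n = x (k + n) := by
  induction k generalizing x n with
  | zero => simp
  | succ k ih =>
    rw [Function.iterate_succ_apply, ih, seqShift]
    congr 1
    omega

variable {P : Measure Ω} {ξ : ℕ → Ω → ℝ}

theorem IsStationarySeq.measurePreserving_seqShift [IsProbabilityMeasure P]
    (hm : ∀ n, Measurable (ξ n)) (hs : IsStationarySeq P ξ) :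
    MeasurePreserving seqShift (P.map fun ω n => ξ n ω) (P.map fun ω n => ξ n ω) := by
  have hξ : Measurable fun ω n => ξ n ω := measurable_pi_lambda _ hm
  have : IsProbabilityMeasure (P.map fun ω n => ξ n ω) :=
    Measure.isProbabilityMeasure_map hξ.aemeasurable
  have : IsProbabilityMeasure ((P.map fun ω n => ξ n ω).map seqShift) :=
    Measure.isProbabilityMeasure_map measurable_seqShift.aemeasurable
  refine ⟨measurable_seqShift, ?_⟩
  refine ext_of_generate_finite initialBoxes generateFrom_initialBoxes isPiSystem_initialBoxes ?_
    (by simp)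
  rintro _ ⟨n, a, rfl⟩
  have hb := measurableSet_initialBox n a
  rw [Measure.map_apply measurable_seqShift hb, Measure.map_apply hξ (measurable_seqShift hb),
    Measure.map_apply hξ hb]
  convert (hs 1 n fun i => a i).symm using 2
  · ext ω
    simp only [Set.mem_preimage, Set.mem_ofPred_eq, seqShift, Fin.forall_iff, add_comm]
  · ext ω
    simp only [Set.mem_preimage, Set.mem_ofPred_eq, Fin.forall_iff]

/-- A shift-invariant Borel set equals its preimage under every iterate of the shift, so it pulls
back to an invariant event, with the same set serving every starting index. -/
theorem IsErgodicSeq.ergodic_seqShift [IsProbabilityMeasure P]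
    (hm : ∀ n, Measurable (ξ n)) (hs : IsStationarySeq P ξ) (he : IsErgodicSeq P ξ) :
    Ergodic seqShift (P.map fun ω n => ξ n ω) := by
  have hξ : Measurable fun ω n => ξ n ω := measurable_pi_lambda _ hm
  have : IsProbabilityMeasure (P.map fun ω n => ξ n ω) :=
    Measure.isProbabilityMeasure_map hξ.aemeasurable
  refine ⟨hs.measurePreserving_seqShift hm, ⟨fun B hB hinv => ?_⟩⟩
  have hA : IsInvariantEvent ξ ((fun ω n => ξ n ω) ⁻¹' B) := by
    refine ⟨hξ hB, B, hB, fun k => ?_⟩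
    have hk : seqShift^[k] ⁻¹' B = B := Function.IsFixedPt.preimage_iterate hinv k
    ext ω
    conv_lhs => rw [← hk]
    simp only [Set.mem_preimage, Set.mem_ofPred_eq]
    rw [show seqShift^[k] (fun n => ξ n ω) = fun n => ξ (k + n) ω from
      funext fun n => seqShift_iterate_apply k _ n]
  rw [eventuallyConst_set']
  rcases he _ hA with h | h
  · left
    rw [← Measure.map_apply hξ hB] at h
    exact ae_eq_empty.2 h
  · right
    rw [← Measure.map_apply hξ hB] at h
    rw [ae_eq_univ, prob_compl_eq_zero_iff hB]
    exact h

/-- The strong law of large numbers for stationary ergodic sequences. -/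
theorem IsErgodicSeq.ae_tendsto_sum_div [IsProbabilityMeasure P]
    (hm : ∀ n, Measurable (ξ n)) (hs : IsStationarySeq P ξ) (he : IsErgodicSeq P ξ)
    {g : ℝ → ℝ} (hg : Measurable g) (hgi : Integrable g (P.map (ξ 0))) :
    ∀ᵐ ω ∂P, Tendsto (fun n : ℕ => (∑ i ∈ Finset.range n, g (ξ i ω)) / n) atTop
      (𝓝 (∫ x, g x ∂(P.map (ξ 0)))) := by
  have hξ : Measurable fun ω n => ξ n ω := measurable_pi_lambda _ hm
  have : IsProbabilityMeasure (P.map fun ω n => ξ n ω) :=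
    Measure.isProbabilityMeasure_map hξ.aemeasurable
  have hmap : (P.map fun ω n => ξ n ω).map (fun x : ℕ → ℝ => x 0) = P.map (ξ 0) :=
    Measure.map_map (measurable_pi_apply 0) hξ
  have hg0 : Measurable fun x : ℕ → ℝ => g (x 0) := hg.comp (measurable_pi_apply 0)
  have hi : Integrable (fun x : ℕ → ℝ => g (x 0)) (P.map fun ω n => ξ n ω) := by
    rw [← hmap] at hgi
    exact hgi.comp_measurable (measurable_pi_apply 0)
  have key := (he.ergodic_seqShift hm hs).ae_tendsto_birkhoffSum_div hg0 hi
  rw [← integral_map (φ := fun x : ℕ → ℝ => x 0) (measurable_pi_apply 0).aemeasurable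
    hg.aestronglyMeasurable, hmap] at key
  filter_upwards [ae_of_ae_map hξ.aemeasurable key] with ω hω
  simpa [birkhoffSum, seqShift_iterate_apply] using hω

end StationarySequences

/-! ### Intermediate values of nonatomic measures -/

section Nonatomic

variable {Ω : Type*} [MeasurableSpace Ω] {P : Measure Ω}

theorem IsNonatomic.exists_subset_measure_le_half [IsFiniteMeasure P] (hP : IsNonatomic P)
    {A : Set Ω} (hA : MeasurableSet A) (h0 : 0 < P A) :
    ∃ B ⊆ A, MeasurableSet B ∧ 0 < P B ∧ P B ≤ P A / 2 := by
  obtain ⟨B, hBA, hB, hB0, hBlt⟩ := hP A hA h0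
  rcases le_or_gt (P B) (P A / 2) with h | h
  · exact ⟨B, hBA, hB, hB0, h⟩
  · have hd : P (A \ B) = P A - P B := measure_sdiff hBA hB.nullMeasurableSet (measure_ne_top _ _)
    refine ⟨A \ B, Set.sdiff_subset, hA.diff hB, ?_, ?_⟩
    · rw [hd]
      exact tsub_pos_of_lt hBlt
    · rw [hd, tsub_le_iff_right]
      calc P A = P A / 2 + P A / 2 := (ENNReal.add_halves _).symm
        _ ≤ _ := by gcongr

theorem IsNonatomic.exists_subset_measure_lt [IsFiniteMeasure P] (hP : IsNonatomic P)
    {A : Set Ω} (hA : MeasurableSet A) (h0 : 0 < P A) {ε : ℝ≥0∞} (hε : 0 < ε) :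
    ∃ B ⊆ A, MeasurableSet B ∧ 0 < P B ∧ P B < ε := by
  have key : ∀ n : ℕ, ∃ B ⊆ A, MeasurableSet B ∧ 0 < P B ∧ P B ≤ P A * 2⁻¹ ^ n := by
    intro n
    induction n with
    | zero => exact ⟨A, subset_rfl, hA, h0, by simp⟩
    | succ n ih =>
      obtain ⟨B, hBA, hB, hB0, hle⟩ := ih
      obtain ⟨C, hCB, hC, hC0, hCle⟩ := hP.exists_subset_measure_le_half hB hB0
      refine ⟨C, hCB.trans hBA, hC, hC0, hCle.trans ?_⟩
      rw [pow_succ, ← mul_assoc, div_eq_mul_inv]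
      gcongr
  have hlim : Tendsto (fun n : ℕ => P A * 2⁻¹ ^ n) atTop (𝓝 (P A * 0)) :=
    ENNReal.Tendsto.const_mul (ENNReal.tendsto_pow_atTop_nhds_zero_of_lt_one
      ENNReal.one_half_lt_one) (Or.inr (measure_ne_top _ _))
  rw [mul_zero] at hlim
  obtain ⟨n, hn⟩ := (hlim.eventually_lt_const hε).exists
  obtain ⟨B, hBA, hB, hB0, hle⟩ := key n
  exact ⟨B, hBA, hB, hB0, hle.trans_lt hn⟩

/-- Sierpiński's theorem: a nonatomic finite measure takes all intermediate values. -/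
theorem IsNonatomic.exists_subset_measure_eq [IsFiniteMeasure P] (hP : IsNonatomic P)
    {A : Set Ω} (hA : MeasurableSet A) {t : ℝ≥0∞} (ht : t ≤ P A) :
    ∃ B ⊆ A, MeasurableSet B ∧ P B = t := by
  -- Greedy exhaustion: among the admissible enlargements of `B`, choose one whose gain is at least
  -- half the supremum of the gains.
  let Adm : Set Ω → Set (Set Ω) := fun B => {C | MeasurableSet C ∧ B ⊆ C ∧ C ⊆ A ∧ P C ≤ t}
  have hstep : ∀ B : Set Ω, ∃ C : Set Ω, (MeasurableSet B ∧ B ⊆ A ∧ P B ≤ t) →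
      (MeasurableSet C ∧ C ⊆ A ∧ P C ≤ t) ∧ B ⊆ C ∧
        ∀ D ∈ Adm B, P (D \ B) ≤ 2 * P (C \ B) := by
    intro B
    by_cases hB : MeasurableSet B ∧ B ⊆ A ∧ P B ≤ t
    swap
    · exact ⟨∅, fun h => absurd h hB⟩
    set s := ⨆ D ∈ Adm B, P (D \ B) with hs
    have hsfin : s ≠ ∞ := ne_top_of_le_ne_top (measure_ne_top P Set.univ)
      (iSup₂_le fun D _ => measure_mono (Set.subset_univ _))
    rcases eq_or_ne s 0 with h0 | h0
    · refine ⟨B, fun _ => ⟨hB, subset_rfl, fun D hD => ?_⟩⟩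
      have : P (D \ B) ≤ s := le_iSup₂ (f := fun D (_ : D ∈ Adm B) => P (D \ B)) D hD
      rw [h0] at this
      exact this.trans zero_le
    · have hlt : s / 2 < s := ENNReal.half_lt_self h0 hsfin
      rw [hs, lt_iSup_iff] at hlt
      obtain ⟨C, hC⟩ := hlt
      rw [lt_iSup_iff] at hC
      obtain ⟨hCadm, hC⟩ := hC
      refine ⟨C, fun _ => ⟨⟨hCadm.1, hCadm.2.2⟩, hCadm.2.1, fun D hD => ?_⟩⟩
      have h1 : P (D \ B) ≤ s := le_iSup₂ (f := fun D (_ : D ∈ Adm B) => P (D \ B)) D hD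
      rw [← hs] at hC
      calc P (D \ B) ≤ s := h1
        _ = 2 * (s / 2) := (ENNReal.mul_div_cancel two_ne_zero ENNReal.ofNat_ne_top).symm
        _ ≤ _ := by gcongr
  choose next hnext using hstep
  let B : ℕ → Set Ω := fun n => next^[n] ∅
  have hsucc : ∀ n, B (n + 1) = next (B n) := fun n => Function.iterate_succ_apply' _ _ _
  have hB : ∀ n, MeasurableSet (B n) ∧ B n ⊆ A ∧ P (B n) ≤ t := by
    intro n
    induction n with
    | zero => simp [B]
    | succ n ih => rw [hsucc]; exact (hnext _ ih).1
  have hmono : Monotone B := monotone_nat_of_le_succ fun n => by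
    rw [hsucc]; exact (hnext _ (hB n)).2.1
  have hlim : Tendsto (fun n => P (B n)) atTop (𝓝 (P (⋃ n, B n))) :=
    tendsto_measure_iUnion_atTop hmono
  have hle : P (⋃ n, B n) ≤ t := le_of_tendsto' hlim fun n => (hB n).2.2
  have hUm : MeasurableSet (⋃ n, B n) := MeasurableSet.iUnion fun n => (hB n).1
  have hUA : (⋃ n, B n) ⊆ A := Set.iUnion_subset fun n => (hB n).2.1
  refine ⟨⋃ n, B n, hUA, hUm, hle.antisymm ?_⟩
  -- If the union fell short of `t`, a small set `C` of positive measure could be added at every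
  -- stage; the greedy choice would gain at least `P C / 2` each time, but the gains tend to zero.
  by_contra! hlt
  have hpos : 0 < P (A \ ⋃ n, B n) := by
    rw [measure_sdiff hUA hUm.nullMeasurableSet (measure_ne_top _ _)]
    exact tsub_pos_of_lt (hlt.trans_le ht)
  obtain ⟨C, hCsub, hC, hC0, hCt⟩ :=
    hP.exists_subset_measure_lt (hA.diff hUm) hpos (tsub_pos_of_lt hlt)
  have hadm : ∀ n, P C ≤ 2 * (P (B (n + 1)) - P (B n)) := by
    intro n
    have hdisj : Disjoint C (B n) :=
      Set.disjoint_left.2 fun x hx hxB => (hCsub hx).2 (Set.mem_iUnion.2 ⟨n, hxB⟩)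
    have h1 : B n ∪ C ∈ Adm (B n) := by
      refine ⟨(hB n).1.union hC, Set.subset_union_left,
        Set.union_subset (hB n).2.1 fun x hx => (hCsub hx).1, ?_⟩
      calc P (B n ∪ C) ≤ P (B n) + P C := measure_union_le _ _
        _ ≤ P (⋃ n, B n) + (t - P (⋃ n, B n)) := by
          gcongr
          exact Set.subset_iUnion B n
        _ = t := add_tsub_cancel_of_le hle
    have h2 := (hnext _ (hB n)).2.2 _ h1
    rw [← hsucc, Set.union_sdiff_left, hdisj.sdiff_eq_left,
      measure_sdiff (hmono n.le_succ) (hB n).1.nullMeasurableSet (measure_ne_top _ _)] at h2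
    exact h2
  have hlim2 : Tendsto (fun n => 2 * (P (B (n + 1)) - P (B n))) atTop
      (𝓝 (2 * (P (⋃ n, B n) - P (⋃ n, B n)))) :=
    ENNReal.Tendsto.const_mul (ENNReal.Tendsto.sub (hlim.comp (tendsto_add_atTop_nat 1)) hlim
      (Or.inl (measure_ne_top _ _))) (Or.inr ENNReal.ofNat_ne_top)
  rw [tsub_self, mul_zero] at hlim2
  exact (ge_of_tendsto' hlim2 hadm).not_gt hC0

theorem IsNonatomic.exists_between_measure_eq [IsFiniteMeasure P] (hP : IsNonatomic P)
    {A C : Set Ω} (hA : MeasurableSet A) (hC : MeasurableSet C) (hAC : A ⊆ C) {t : ℝ≥0∞}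
    (hAt : P A ≤ t) (htC : t ≤ P C) :
    ∃ B, A ⊆ B ∧ B ⊆ C ∧ MeasurableSet B ∧ P B = t := by
  obtain ⟨D, hDsub, hD, hDt⟩ := hP.exists_subset_measure_eq (hC.diff hA) (t := t - P A) (by
    rw [measure_sdiff hAC hA.nullMeasurableSet (measure_ne_top _ _)]
    gcongr)
  refine ⟨A ∪ D, Set.subset_union_left, Set.union_subset hAC fun x hx => (hDsub hx).1,
    hA.union hD, ?_⟩
  rw [measure_union (Set.disjoint_left.2 fun x hx hxD => (hDsub hxD).2 hx) hD, hDt,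
    add_tsub_cancel_of_le hAt]

end Nonatomic

/-! ### A uniform random variable on a nonatomic space -/

section Uniform

variable {Ω : Type*} [MeasurableSpace Ω] {P : Measure Ω}

/-- On a nonatomic probability space there is a monotone family of events indexed by the dyadic
rationals of the unit interval, the probability of each event being its index. -/
theorem IsNonatomic.exists_dyadic_family [IsProbabilityMeasure P] (hP : IsNonatomic P) :
    ∃ D : ℕ → ℕ → Set Ω, (∀ n k, MeasurableSet (D n k)) ∧ (∀ n, Monotone (D n)) ∧
      (∀ n k, D (n + 1) (2 * k) = D n k) ∧ (∀ n k, k ≤ 2 ^ n → P.real (D n k) = k / 2 ^ n) ∧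
      D 0 1 = Set.univ := by
  have hmid : ∀ A C : Set Ω, ∃ B, MeasurableSet A → MeasurableSet C → A ⊆ C →
      A ⊆ B ∧ B ⊆ C ∧ MeasurableSet B ∧ P.real B = (P.real A + P.real C) / 2 := by
    intro A C
    by_cases h : MeasurableSet A ∧ MeasurableSet C ∧ A ⊆ C
    · have hle : P.real A ≤ P.real C := measureReal_mono h.2.2
      obtain ⟨B, hAB, hBC, hB, hBt⟩ := hP.exists_between_measure_eq h.1 h.2.1 h.2.2
        (t := ENNReal.ofReal ((P.real A + P.real C) / 2))
        ((ENNReal.le_ofReal_iff_toReal_le (measure_ne_top _ _)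
          (by positivity)).2 (by change P.real A ≤ _; linarith))
        (ENNReal.ofReal_le_of_le_toReal (by change _ ≤ P.real C; linarith))
      refine ⟨B, fun _ _ _ => ⟨hAB, hBC, hB, ?_⟩⟩
      rw [measureReal_def, hBt, ENNReal.toReal_ofReal (by positivity)]
    · exact ⟨∅, fun h1 h2 h3 => absurd ⟨h1, h2, h3⟩ h⟩
  choose mid hmid using hmid
  -- Even indices inherit the previous level and odd ones interpolate halfway. At level zero every
  -- index from `1` on gives the whole space, so monotonicity needs no restriction on `k`.
  let D : ℕ → ℕ → Set Ω := fun n => Nat.rec (fun k => if k = 0 then ∅ else Set.univ)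
    (fun _ E k => if Even k then E (k / 2) else mid (E (k / 2)) (E (k / 2 + 1))) n
  have heven : ∀ n k, D (n + 1) (2 * k) = D n k := fun n k => by simp [D]
  have hodd : ∀ n k, D (n + 1) (2 * k + 1) = mid (D n k) (D n (k + 1)) := fun n k => by
    have h1 : ¬ Even (2 * k + 1) := by simp
    have h2 : (2 * k + 1) / 2 = k := by omega
    simp only [D, if_neg h1, h2]
  have hmain : ∀ n, (∀ k, MeasurableSet (D n k)) ∧ Monotone (D n) ∧
      ∀ k, k ≤ 2 ^ n → P.real (D n k) = k / 2 ^ n := by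
    intro n
    induction n with
    | zero =>
      refine ⟨fun k => ?_, monotone_nat_of_le_succ fun k => ?_, fun k hk => ?_⟩
      · change MeasurableSet (if k = 0 then ∅ else Set.univ)
        split_ifs <;> simp
      · simp [D]
      · have : k = 0 ∨ k = 1 := by simp at hk; omega
        rcases this with rfl | rfl <;> simp [D]
    | succ n ih =>
      obtain ⟨hm, hmono, hval⟩ := ih
      have hmid' := fun k => hmid _ _ (hm k) (hm (k + 1)) (hmono k.le_succ)
      refine ⟨fun k => ?_, monotone_nat_of_le_succ fun k => ?_, fun k hk => ?_⟩
      · obtain ⟨j, rfl | rfl⟩ := k.even_or_odd'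
        · rw [heven]; exact hm j
        · rw [hodd]; exact (hmid' j).2.2.1
      · obtain ⟨j, rfl | rfl⟩ := k.even_or_odd'
        · rw [heven, hodd]; exact (hmid' j).1
        · rw [hodd, show 2 * j + 1 + 1 = 2 * (j + 1) by ring, heven]; exact (hmid' j).2.1
      · rw [pow_succ] at hk
        obtain ⟨j, rfl | rfl⟩ := k.even_or_odd'
        · rw [heven, hval j (by omega), pow_succ]
          push_cast
          field_simp
        · rw [hodd, (hmid' j).2.2.2, hval j (by omega), hval (j + 1) (by omega), pow_succ]
          push_cast
          field_simp
          ring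
  exact ⟨D, fun n => (hmain n).1, fun n => (hmain n).2.1, heven, fun n => (hmain n).2.2,
    by simp [D]⟩

/-- A nonatomic probability space carries a uniformly distributed random variable. -/
theorem IsNonatomic.exists_uniform [IsProbabilityMeasure P] (hP : IsNonatomic P) :
    ∃ U : Ω → ℝ, Measurable U ∧ P.map U = volume.restrict (Set.Ioo 0 1) := by
  obtain ⟨D, hDm, hDmono, hDtwo, hDval, hDuniv⟩ := hP.exists_dyadic_family
  have hlevel : ∀ m n k, D (n + m) (2 ^ m * k) = D n k := by
    intro m n k
    induction m with
    | zero => simp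
    | succ m ih => rw [pow_succ', mul_assoc, ← add_assoc, hDtwo, ih]
  have hsub : ∀ m j n k : ℕ, (j : ℝ) / 2 ^ m ≤ k / 2 ^ n → D m j ⊆ D n k := by
    intro m j n k h
    rw [← hlevel n m j, ← hlevel m n k, add_comm m n]
    apply hDmono
    rw [div_le_div_iff₀ (by positivity) (by positivity)] at h
    have h' : j * 2 ^ n ≤ k * 2 ^ m := by exact_mod_cast h
    linarith
  -- `U` is the infimum of the dyadic indices of the events containing `ω`, so `{U < t}` is a
  -- countable union of such events.
  let U : Ω → ℝ := fun ω => sInf {x | ∃ n k : ℕ, ω ∈ D n k ∧ (k : ℝ) / 2 ^ n = x}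
  have hne : ∀ ω, {x | ∃ n k : ℕ, ω ∈ D n k ∧ (k : ℝ) / 2 ^ n = x}.Nonempty := fun ω =>
    ⟨1, 0, 1, by simp [hDuniv], by simp⟩
  have hnonneg : ∀ ω, ∀ x ∈ {x | ∃ n k : ℕ, ω ∈ D n k ∧ (k : ℝ) / 2 ^ n = x}, 0 ≤ x := by
    rintro ω _ ⟨n, k, -, rfl⟩
    positivity
  have hU0 : ∀ ω, 0 ≤ U ω := fun ω => le_csInf (hne ω) (hnonneg ω)
  have hlt : ∀ ω t, U ω < t ↔ ∃ n k : ℕ, ω ∈ D n k ∧ (k : ℝ) / 2 ^ n < t := by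
    intro ω t
    rw [csInf_lt_iff ⟨0, hnonneg ω⟩ (hne ω)]
    constructor
    · rintro ⟨_, ⟨n, k, h, rfl⟩, hlt⟩
      exact ⟨n, k, h, hlt⟩
    · rintro ⟨n, k, h, hlt⟩
      exact ⟨_, ⟨n, k, h, rfl⟩, hlt⟩
  have hUm : Measurable U := by
    refine measurable_of_Iio fun t => ?_
    have : U ⁻¹' Set.Iio t = ⋃ (n : ℕ) (k : ℕ) (_ : (k : ℝ) / 2 ^ n < t), D n k := by
      ext ω
      simp only [Set.mem_preimage, Set.mem_Iio, hlt, Set.mem_iUnion, exists_prop, and_comm]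
    rw [this]
    exact MeasurableSet.iUnion fun n => MeasurableSet.iUnion fun k => MeasurableSet.iUnion
      fun _ => hDm n k
  have hval : ∀ t, 0 < t → t ≤ 1 → P.real (U ⁻¹' Set.Iio t) = t := by
    intro t ht0 ht1
    -- `{U < t}` lies between the events of two consecutive dyadic indices of level `n`, whose
    -- interval contains `t`.
    have hbound : ∀ n : ℕ, |P.real (U ⁻¹' Set.Iio t) - t| ≤ (1 / 2) ^ n := by
      intro n
      have hpow : (0 : ℝ) < 2 ^ n := by positivity
      set k := ⌈t * 2 ^ n⌉₊ with hk
      have hk0 : 0 < k := Nat.ceil_pos.2 (by positivity)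
      have hk1 : k ≤ 2 ^ n := by
        refine Nat.ceil_le.2 ?_
        push_cast
        nlinarith
      have hlow : ((k - 1 : ℕ) : ℝ) < t * 2 ^ n := Nat.lt_ceil.1 (by omega)
      have hupp : t * 2 ^ n ≤ k := Nat.le_ceil _
      have hcast : ((k - 1 : ℕ) : ℝ) = k - 1 := by
        rw [Nat.cast_sub hk0]; simp
      have h1 : D n (k - 1) ⊆ U ⁻¹' Set.Iio t := fun ω hω =>
        (hlt ω t).2 ⟨n, k - 1, hω, (div_lt_iff₀ hpow).2 hlow⟩
      have h2 : U ⁻¹' Set.Iio t ⊆ D n k := by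
        intro ω hω
        obtain ⟨m, j, hj, hjt⟩ := (hlt ω t).1 hω
        exact hsub m j n k (hjt.le.trans ((le_div_iff₀ hpow).2 hupp)) hj
      have h3 : P.real (D n (k - 1)) ≤ P.real (U ⁻¹' Set.Iio t) := measureReal_mono h1
      have h4 : P.real (U ⁻¹' Set.Iio t) ≤ P.real (D n k) := measureReal_mono h2
      rw [hDval n _ (by omega), hcast, div_le_iff₀ hpow] at h3
      rw [hDval n _ hk1, le_div_iff₀ hpow] at h4
      rw [hcast] at hlow
      rw [one_div, inv_pow, ← one_div, abs_le, neg_le, le_div_iff₀ hpow, le_div_iff₀ hpow]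
      constructor <;> nlinarith
    have hlim : Tendsto (fun n : ℕ => (1 / 2 : ℝ) ^ n) atTop (𝓝 0) :=
      tendsto_pow_atTop_nhds_zero_of_lt_one (by norm_num) (by norm_num)
    have := ge_of_tendsto' hlim hbound
    exact sub_eq_zero.1 (abs_nonpos_iff.1 this)
  refine ⟨U, hUm, ?_⟩
  have : IsProbabilityMeasure (P.map U) := Measure.isProbabilityMeasure_map hUm.aemeasurable
  refine Measure.ext_of_Ici _ _ fun t => ?_
  rw [Measure.map_apply hUm measurableSet_Ici, Measure.restrict_apply measurableSet_Ici]
  rcases le_or_gt t 0 with h0 | h0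
  · have h1 : U ⁻¹' Set.Ici t = Set.univ := Set.eq_univ_of_forall fun ω => h0.trans (hU0 ω)
    have h2 : Set.Ici t ∩ Set.Ioo 0 1 = Set.Ioo 0 1 :=
      Set.inter_eq_right.2 fun x hx => h0.trans hx.1.le
    rw [h1, h2]
    simp
  rcases le_or_gt t 1 with h1 | h1
  · have h2 : Set.Ici t ∩ Set.Ioo 0 1 = Set.Ico t 1 := by
      ext x
      simp only [Set.mem_inter_iff, Set.mem_Ici, Set.mem_Ioo, Set.mem_Ico]
      constructor
      · rintro ⟨a, -, b⟩; exact ⟨a, b⟩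
      · rintro ⟨a, b⟩; exact ⟨a, h0.trans_le a, b⟩
    have h3 : P.real (U ⁻¹' Set.Ici t) = 1 - t := by
      rw [← Set.compl_Iio, Set.preimage_compl,
        probReal_compl_eq_one_sub (hUm measurableSet_Iio), hval t h0 h1]
    rw [h2, Real.volume_Ico, ← h3, ofReal_measureReal]
  · have h2 : U ⁻¹' Set.Ici t = ∅ := by
      refine Set.eq_empty_of_forall_notMem fun ω hω => ?_
      exact ((hlt ω t).2 ⟨0, 1, by simp [hDuniv], by simpa using h1⟩).not_ge hω
    have h3 : Set.Ici t ∩ Set.Ioo 0 1 = ∅ :=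
      Set.eq_empty_of_forall_notMem fun x hx => (h1.trans_le hx.1).not_gt hx.2.2
    rw [h2, h3]
    simp

end Uniform

/-! ### Quantile functions -/

section Quantile

/-- The (lower) quantile function of a probability distribution on the line. -/
noncomputable def lowerQuantile (ν : Measure ℝ) (u : ℝ) : ℝ :=
  sInf {x | u ≤ ProbabilityTheory.cdf ν x}

variable {ν : Measure ℝ}

/-- Right continuity of the distribution function makes the infimum attained. For `u` in the open
unit interval the defining set is nonempty and bounded below, so `sInf` takes no default value. -/
theorem lowerQuantile_le_iff {u : ℝ} (hu : u ∈ Set.Ioo (0 : ℝ) 1) {x : ℝ} :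
    lowerQuantile ν u ≤ x ↔ u ≤ ProbabilityTheory.cdf ν x := by
  have hne : {x | u ≤ ProbabilityTheory.cdf ν x}.Nonempty :=
    (((ProbabilityTheory.tendsto_cdf_atTop ν).eventually_const_lt hu.2).mono fun _ h => h.le).exists
  have hbdd : BddBelow {x | u ≤ ProbabilityTheory.cdf ν x} := by
    obtain ⟨y, hy⟩ :=
      ((ProbabilityTheory.tendsto_cdf_atBot ν).eventually_lt_const hu.1).exists
    refine ⟨y, fun x hx => ?_⟩
    by_contra! h
    exact (hx.trans ((ProbabilityTheory.monotone_cdf ν) h.le)).not_gt hy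
  constructor
  · intro h
    have hlim : Tendsto (ProbabilityTheory.cdf ν) (𝓝[>] x) (𝓝 (ProbabilityTheory.cdf ν x)) :=
      ((ProbabilityTheory.cdf ν).right_continuous x).mono_left
        (nhdsWithin_mono x Set.Ioi_subset_Ici_self)
    refine ge_of_tendsto hlim ?_
    filter_upwards [self_mem_nhdsWithin] with y hy
    obtain ⟨z, hz, hzy⟩ := (csInf_lt_iff hbdd hne).1 (h.trans_lt hy)
    exact hz.trans ((ProbabilityTheory.monotone_cdf ν) hzy.le)
  · exact fun h => csInf_le hbdd h

theorem aemeasurable_lowerQuantile (ν : Measure ℝ) :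
    AEMeasurable (lowerQuantile ν) (volume.restrict (Set.Ioo 0 1)) := by
  refine aemeasurable_restrict_of_monotoneOn measurableSet_Ioo fun u hu v hv huv => ?_
  exact (lowerQuantile_le_iff hu).2 (huv.trans ((lowerQuantile_le_iff hv).1 le_rfl))

theorem map_lowerQuantile (ν : Measure ℝ) [IsProbabilityMeasure ν] :
    (volume.restrict (Set.Ioo 0 1)).map (lowerQuantile ν) = ν := by
  refine Measure.ext_of_Iic _ _ fun a => ?_
  rw [Measure.map_apply_of_aemeasurable (aemeasurable_lowerQuantile ν) measurableSet_Iic,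
    Measure.restrict_apply' measurableSet_Ioo, ← ProbabilityTheory.ofReal_cdf]
  have hset : lowerQuantile ν ⁻¹' Set.Iic a ∩ Set.Ioo 0 1
      = Set.Iic (ProbabilityTheory.cdf ν a) ∩ Set.Ioo 0 1 := by
    ext u
    simp only [Set.mem_inter_iff, Set.mem_preimage, Set.mem_Iic, and_congr_left_iff]
    exact fun hu => lowerQuantile_le_iff hu
  rw [hset]
  have h0 := ProbabilityTheory.cdf_nonneg ν a
  have h1 := ProbabilityTheory.cdf_le_one ν a
  refine le_antisymm ?_ ?_
  · calc _ ≤ volume (Set.Ioc 0 (ProbabilityTheory.cdf ν a)) :=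
        measure_mono fun u hu => ⟨hu.2.1, hu.1⟩
      _ = _ := by rw [Real.volume_Ioc, sub_zero]
  · calc ENNReal.ofReal (ProbabilityTheory.cdf ν a)
        = volume (Set.Ioo 0 (ProbabilityTheory.cdf ν a)) := by rw [Real.volume_Ioo, sub_zero]
      _ ≤ _ := measure_mono fun u hu => Set.mem_inter (Set.mem_Iic.2 hu.2.le) (Set.mem_Ioo.2 ⟨hu.1, hu.2.trans_le h1⟩)

/-- Convergence of the distribution functions at the rationals implies the almost everywhere
convergence of the quantile functions. -/
theorem ae_tendsto_lowerQuantile {νs : ℕ → Measure ℝ}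
    (h : ∀ r : ℚ, Tendsto (fun n => ProbabilityTheory.cdf (νs n) r) atTop
      (𝓝 (ProbabilityTheory.cdf ν r))) :
    ∀ᵐ u ∂(volume.restrict (Set.Ioo (0 : ℝ) 1)),
      Tendsto (fun n => lowerQuantile (νs n) u) atTop (𝓝 (lowerQuantile ν u)) := by
  have hcount : (Set.range fun r : ℚ => ProbabilityTheory.cdf ν r).Countable :=
    Set.countable_range _
  -- Discarding the countably many levels attained by the limit distribution function at rationals
  -- turns `u ≤ F(r)` into the strict inequality that survives in the limit.
  filter_upwards [ae_restrict_mem measurableSet_Ioo,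
    (hcount.ae_notMem volume).filter_mono (ae_mono Measure.restrict_le_self)] with u hu hur
  refine tendsto_order.2 ⟨fun a ha => ?_, fun a ha => ?_⟩
  · obtain ⟨r, har, hr⟩ := exists_rat_btwn ha
    have hr' : ProbabilityTheory.cdf ν r < u := by
      rw [← not_le, ← lowerQuantile_le_iff hu]
      exact hr.not_ge
    filter_upwards [(h r).eventually_lt_const hr'] with n hn
    refine har.trans ?_
    rw [← not_le, lowerQuantile_le_iff hu]
    exact hn.not_ge
  · obtain ⟨r, hr, hra⟩ := exists_rat_btwn ha
    have hr' : u < ProbabilityTheory.cdf ν r :=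
      lt_of_le_of_ne ((lowerQuantile_le_iff hu).1 hr.le) fun he => hur ⟨r, he.symm⟩
    filter_upwards [(h r).eventually_const_lt hr'] with n hn
    exact ((lowerQuantile_le_iff hu).2 hn.le).trans_lt hra

end Quantile

/-! ### Dominated convergence with varying bounds -/

section GeneralizedDominatedConvergence

variable {α : Type*} [MeasurableSpace α] {μ : Measure α}

/-- A version of the dominated convergence theorem in which the dominating functions vary, but
converge together with their integrals. -/
theorem tendsto_lintegral_zero_of_tendsto_bound {f h : ℕ → α → ℝ≥0∞} {H : α → ℝ≥0∞}
    (hf : ∀ n, AEMeasurable (f n) μ) (hh : ∀ n, AEMeasurable (h n) μ) (hH : AEMeasurable H μ)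
    (hle : ∀ n, f n ≤ᵐ[μ] h n) (hf0 : ∀ᵐ x ∂μ, Tendsto (fun n => f n x) atTop (𝓝 0))
    (hhH : ∀ᵐ x ∂μ, Tendsto (fun n => h n x) atTop (𝓝 (H x))) (hfin : ∫⁻ x, H x ∂μ ≠ ∞)
    (hint : Tendsto (fun n => ∫⁻ x, h n x ∂μ) atTop (𝓝 (∫⁻ x, H x ∂μ))) :
    Tendsto (fun n => ∫⁻ x, f n x ∂μ) atTop (𝓝 0) := by
  -- The estimate is `f ≤ min f H + (h - H)` with truncated subtraction. The first term is dominated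
  -- by `H`; the second equals `h - min h H`, where both integrals tend to `∫ H`.
  have h1 : Tendsto (fun n => ∫⁻ x, min (f n x) (H x) ∂μ) atTop (𝓝 (∫⁻ _, 0 ∂μ)) := by
    refine tendsto_lintegral_of_dominated_convergence' H (fun n => (hf n).min hH)
      (fun n => ae_of_all _ fun x => min_le_right _ _) hfin ?_
    filter_upwards [hf0] with x hx
    simpa using hx.min (tendsto_const_nhds (x := H x))
  have h2 : Tendsto (fun n => ∫⁻ x, min (h n x) (H x) ∂μ) atTop (𝓝 (∫⁻ x, H x ∂μ)) := by
    refine tendsto_lintegral_of_dominated_convergence' H (fun n => (hh n).min hH)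
      (fun n => ae_of_all _ fun x => min_le_right _ _) hfin ?_
    filter_upwards [hhH] with x hx
    simpa using hx.min (tendsto_const_nhds (x := H x))
  have h3 : Tendsto (fun n => ∫⁻ x, (h n x - H x) ∂μ) atTop (𝓝 0) := by
    have := ENNReal.Tendsto.sub hint h2 (Or.inl hfin)
    rw [tsub_self] at this
    refine this.congr fun n => (ENNReal.eq_sub_of_add_eq ?_ ?_).symm
    · exact ne_top_of_le_ne_top hfin (lintegral_mono fun x => min_le_right _ _)
    · rw [← lintegral_add_right' _ ((hh n).min hH)]
      exact lintegral_congr fun x => tsub_add_min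
  rw [lintegral_zero] at h1
  have h4 := h1.add h3
  rw [add_zero] at h4
  refine tendsto_of_tendsto_of_tendsto_of_le_of_le tendsto_const_nhds h4 (fun n => zero_le)
    fun n => ?_
  simp only
  rw [← lintegral_add_left' ((hf n).min hH)]
  refine lintegral_mono_ae ?_
  filter_upwards [hle n] with x hx
  calc f n x = (f n x - H x) + min (f n x) (H x) := tsub_add_min.symm
    _ ≤ min (f n x) (H x) + (h n x - H x) := by rw [add_comm]; gcongr

end GeneralizedDominatedConvergence

/-! ### Orlicz functions and modular convergence -/

section OrliczFunctions

variable {Φ : ℝ≥0 → ℝ≥0}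

theorem IsOrliczFunction.map_combo_le (hΦ : IsOrliczFunction Φ) {a b : ℝ≥0} (hab : a + b = 1)
    (x y : ℝ≥0) : Φ (a * x + b * y) ≤ a * Φ x + b * Φ y :=
  hΦ.convex.2 (Set.mem_univ x) (Set.mem_univ y) zero_le zero_le hab

/-- Extended by zero to the negative half-line, `Φ` is a finite convex function on all of `ℝ`, so
continuity holds at the endpoint `0` as well. -/
theorem IsOrliczFunction.continuous (hΦ : IsOrliczFunction Φ) : Continuous Φ := by
  have hconv : ConvexOn ℝ Set.univ fun x : ℝ => (Φ x.toNNReal : ℝ) := by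
    refine ⟨convex_univ, fun x _ y _ a b ha hb hab => ?_⟩
    lift a to ℝ≥0 using ha
    lift b to ℝ≥0 using hb
    have h1 : ((a : ℝ) * x + b * y).toNNReal ≤ a * x.toNNReal + b * y.toNNReal := by
      refine Real.toNNReal_le_iff_le_coe.2 ?_
      push_cast
      gcongr <;> exact Real.le_coe_toNNReal _
    have h2 := (hΦ.increasing h1).trans (hΦ.map_combo_le (by exact_mod_cast hab) _ _)
    simp only [smul_eq_mul]
    exact_mod_cast h2
  have hcont : Continuous fun x : ℝ => (Φ x.toNNReal : ℝ) :=
    continuousOn_univ.1 (hconv.continuousOn isOpen_univ)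
  have := (continuous_real_toNNReal.comp hcont).comp NNReal.continuous_coe
  simpa [Function.comp_def] using this

/-- Convexity and `Φ 0 = 0` give `n Φ(y) ≤ Φ(n y)`, hence growth at least linear once `Φ(y) > 0`. -/
theorem IsOrliczFunction.exists_lt (hΦ : IsOrliczFunction Φ) (C : ℝ≥0) : ∃ x, C < Φ x := by
  obtain ⟨y, hy⟩ : ∃ y, 0 < Φ y := by
    by_contra! h
    obtain ⟨x, y, hxy⟩ := hΦ.nonconstant
    exact hxy ((le_antisymm (h x) zero_le).trans (le_antisymm (h y) zero_le).symm)
  obtain ⟨n, hn⟩ := exists_nat_gt (C / Φ y)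
  have hn0 : (0 : ℝ≥0) < n := zero_le.trans_lt hn
  refine ⟨n * y, ?_⟩
  have hn1 : ((n : ℝ≥0))⁻¹ ≤ 1 := inv_le_one_of_one_le₀ (by
    have : n ≠ 0 := by rintro rfl; simp at hn0
    exact_mod_cast Nat.one_le_iff_ne_zero.2 this)
  have h1 := hΦ.map_combo_le (add_tsub_cancel_of_le hn1) (n * y) 0
  rw [hΦ.map_zero, mul_zero, add_zero, add_zero, inv_mul_cancel_left₀ hn0.ne'] at h1
  calc C < n * Φ y := (div_lt_iff₀ hy).1 hn
    _ ≤ n * ((n : ℝ≥0)⁻¹ * Φ (n * y)) := by gcongr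
    _ = _ := mul_inv_cancel_left₀ hn0.ne' _

theorem IsOrliczFunction.map_mul_nnnorm_sub_le (hΦ : IsOrliczFunction Φ) (c : ℝ≥0) (x y : ℝ) :
    Φ (c * ‖x - y‖₊) ≤ Φ (2 * c * ‖x‖₊) + Φ (2 * c * ‖y‖₊) := by
  have h2 : (2⁻¹ : ℝ≥0) + 2⁻¹ = 1 := by
    rw [← two_mul]
    exact mul_inv_cancel₀ two_ne_zero
  have hle : (2⁻¹ : ℝ≥0) ≤ 1 := h2 ▸ le_self_add
  calc Φ (c * ‖x - y‖₊) ≤ Φ (2⁻¹ * (2 * c * ‖x‖₊) + 2⁻¹ * (2 * c * ‖y‖₊)) := by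
        refine hΦ.increasing ?_
        have : (2⁻¹ : ℝ≥0) * (2 * c * ‖x‖₊) + 2⁻¹ * (2 * c * ‖y‖₊) = c * (‖x‖₊ + ‖y‖₊) := by
          field_simp
        rw [this]
        gcongr
        exact nnnorm_sub_le x y
    _ ≤ _ := hΦ.map_combo_le h2 _ _
    _ ≤ _ := add_le_add (mul_le_of_le_one_left' hle) (mul_le_of_le_one_left' hle)

theorem IsOrliczFunction.measurable_modular (hΦ : IsOrliczFunction Φ) (c : ℝ≥0) :
    Measurable fun x : ℝ => (Φ (c * ‖x‖₊) : ℝ≥0∞) :=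
  (hΦ.increasing.measurable.comp (measurable_nnnorm.const_mul c)).coe_nnreal_ennreal

variable {Ω : Type*} [MeasurableSpace Ω] {P : Measure Ω}

/-- Almost sure convergence and convergence of the modulars imply modular convergence. -/
theorem IsOrliczFunction.tendsto_modular_sub (hΦ : IsOrliczFunction Φ) {Y : ℕ → Ω → ℝ}
    {Z : Ω → ℝ} (hY : ∀ n, AEMeasurable (Y n) P) (hZ : AEMeasurable Z P)
    (hYZ : ∀ᵐ ω ∂P, Tendsto (fun n => Y n ω) atTop (𝓝 (Z ω))) (c : ℝ≥0)
    (hfin : ∫⁻ ω, (Φ (2 * c * ‖Z ω‖₊) : ℝ≥0∞) ∂P ≠ ∞)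
    (hmod : Tendsto (fun n => ∫⁻ ω, (Φ (2 * c * ‖Y n ω‖₊) : ℝ≥0∞) ∂P) atTop
      (𝓝 (∫⁻ ω, (Φ (2 * c * ‖Z ω‖₊) : ℝ≥0∞) ∂P))) :
    Tendsto (fun n => ∫⁻ ω, (Φ (c * ‖Y n ω - Z ω‖₊) : ℝ≥0∞) ∂P) atTop (𝓝 0) := by
  have hmY : ∀ n, AEMeasurable (fun ω => (Φ (2 * c * ‖Y n ω‖₊) : ℝ≥0∞)) P := fun n =>
    (hΦ.measurable_modular _).comp_aemeasurable (hY n)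
  have hmZ : AEMeasurable (fun ω => (Φ (2 * c * ‖Z ω‖₊) : ℝ≥0∞)) P :=
    (hΦ.measurable_modular _).comp_aemeasurable hZ
  refine tendsto_lintegral_zero_of_tendsto_bound
    (h := fun n ω => (Φ (2 * c * ‖Y n ω‖₊) : ℝ≥0∞) + Φ (2 * c * ‖Z ω‖₊))
    (H := fun ω => (Φ (2 * c * ‖Z ω‖₊) : ℝ≥0∞) + Φ (2 * c * ‖Z ω‖₊))
    (fun n => (hΦ.measurable_modular _).comp_aemeasurable ((hY n).sub hZ))
    (fun n => (hmY n).add hmZ) (hmZ.add hmZ) (fun n => ae_of_all _ fun ω => ?_) ?_ ?_ ?_ ?_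
  · simp only
    rw [← ENNReal.coe_add, ENNReal.coe_le_coe]
    exact hΦ.map_mul_nnnorm_sub_le c (Y n ω) (Z ω)
  · filter_upwards [hYZ] with ω hω
    have hcont : Continuous fun x : ℝ => (Φ (c * ‖x - Z ω‖₊) : ℝ≥0∞) :=
      ENNReal.continuous_coe.comp (hΦ.continuous.comp (by fun_prop))
    have := (hcont.tendsto (Z ω)).comp hω
    simpa [hΦ.map_zero, Function.comp_def] using this
  · filter_upwards [hYZ] with ω hω
    have hcont : Continuous fun x : ℝ => (Φ (2 * c * ‖x‖₊) : ℝ≥0∞) :=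
      ENNReal.continuous_coe.comp (hΦ.continuous.comp (by fun_prop))
    exact ((hcont.tendsto (Z ω)).comp hω).add_const _
  · rw [lintegral_add_left' hmZ]
    exact ENNReal.add_ne_top.2 ⟨hfin, hfin⟩
  · simp_rw [lintegral_add_right' _ hmZ]
    exact hmod.add_const _

theorem mk_mem_orliczHeart (hΦ : IsOrliczFunction Φ) {Z : Ω → ℝ} (hZ : AEStronglyMeasurable Z P)
    (h : ∀ c : ℝ≥0, 0 < c → ∫⁻ ω, (Φ (c * ‖Z ω‖₊) : ℝ≥0∞) ∂P < ∞) :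
    AEEqFun.mk Z hZ ∈ orliczHeart hΦ P := by
  intro c hc
  have heq : (fun ω => (Φ (c * ‖AEEqFun.mk Z hZ ω‖₊) : ℝ≥0∞))
      =ᵐ[P] fun ω => (Φ (c * ‖Z ω‖₊) : ℝ≥0∞) := by
    filter_upwards [AEEqFun.coeFn_mk Z hZ] with ω hω
    rw [hω]
  rw [lintegral_congr_ae heq]
  exact h c hc

end OrliczFunctions

/-! ### Continuity of convex functionals that are order bounded above -/

section Continuity

/-- A convex functional that is order bounded above is sequentially continuous with respect to
relatively uniform convergence. -/
theorem ConvexOn.tendsto_of_relatively_uniform {E : Type*} [AddCommGroup E] [Module ℝ E]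
    [Preorder E] {ρ : E → ℝ} (hconv : ConvexOn ℝ Set.univ ρ) (hbdd : OrderBoundedAbove ρ)
    {Y : ℕ → E} {Z A B : E}
    (hadd : ∀ n : ℕ, Z + ((n : ℝ) + 1) • (Y n - Z) ∈ Set.Icc A B)
    (hsub : ∀ n : ℕ, Z - ((n : ℝ) + 1) • (Y n - Z) ∈ Set.Icc A B) :
    Tendsto (fun n => ρ (Y n)) atTop (𝓝 (ρ Z)) := by
  obtain ⟨M, hM⟩ := hbdd A B ((hadd 0).1.trans (hadd 0).2)
  have hM' : ∀ W ∈ Set.Icc A B, ρ W ≤ M := fun W hW => hM ⟨W, hW, rfl⟩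
  have h0 : Tendsto (fun n : ℕ => 1 / ((n : ℝ) + 1)) atTop (𝓝 0) :=
    tendsto_one_div_add_atTop_nhds_zero_nat
  have hlow : Tendsto (fun n : ℕ => (1 + 1 / ((n : ℝ) + 1)) * ρ Z - 1 / ((n : ℝ) + 1) * M) atTop
      (𝓝 ((1 + 0) * ρ Z - 0 * M)) := ((h0.const_add 1).mul_const _).sub (h0.mul_const _)
  have hupp : Tendsto (fun n : ℕ => (1 - 1 / ((n : ℝ) + 1)) * ρ Z + 1 / ((n : ℝ) + 1) * M) atTop
      (𝓝 ((1 - 0) * ρ Z + 0 * M)) := ((h0.const_sub 1).mul_const _).add (h0.mul_const _)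
  rw [add_zero, one_mul, zero_mul, sub_zero] at hlow
  rw [sub_zero, one_mul, zero_mul, add_zero] at hupp
  refine tendsto_of_tendsto_of_tendsto_of_le_of_le hlow hupp (fun n => ?_) fun n => ?_
  · have hn : (0 : ℝ) < (n : ℝ) + 1 := by positivity
    -- Lower bound: `Z` is a convex combination of `Y n` and the reflected point `Z - (n+1)(Y n -
    -- Z)`, the latter with weight `1/(n+2)`.
    have hconvn := hconv.2 (Set.mem_univ (Y n))
      (Set.mem_univ (Z - ((n : ℝ) + 1) • (Y n - Z)))
      (show 0 ≤ ((n : ℝ) + 1) / (n + 2) by positivity) (show 0 ≤ 1 / ((n : ℝ) + 2) by positivity)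
      (by field_simp; ring)
    have heq : (((n : ℝ) + 1) / (n + 2)) • Y n
        + (1 / ((n : ℝ) + 2)) • (Z - ((n : ℝ) + 1) • (Y n - Z)) = Z := by
      match_scalars <;> field_simp <;> ring
    rw [heq, smul_eq_mul, smul_eq_mul] at hconvn
    have hb := hM' _ (hsub n)
    have h2 : ρ Z ≤ ((n : ℝ) + 1) / (n + 2) * ρ (Y n) + 1 / ((n : ℝ) + 2) * M :=
      hconvn.trans (by gcongr)
    simp only
    rw [show (1 + 1 / ((n : ℝ) + 1)) * ρ Z - 1 / ((n : ℝ) + 1) * M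
      = (((n : ℝ) + 2) * ρ Z - M) / (n + 1) by field_simp; ring, div_le_iff₀ hn]
    rw [div_mul_eq_mul_div, div_mul_eq_mul_div, ← add_div, le_div_iff₀ (by positivity)] at h2
    linarith
  · have hn : (0 : ℝ) < (n : ℝ) + 1 := by positivity
    -- Upper bound: `Y n` lies between `Z` and `Z + (n+1)(Y n - Z)`, the latter with weight
    -- `1/(n+1)`.
    have hconvn := hconv.2 (Set.mem_univ Z)
      (Set.mem_univ (Z + ((n : ℝ) + 1) • (Y n - Z)))
      (show 0 ≤ 1 - 1 / ((n : ℝ) + 1) by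
        rw [sub_nonneg, div_le_one hn]
        exact le_add_of_nonneg_left n.cast_nonneg)
      (show 0 ≤ 1 / ((n : ℝ) + 1) by positivity) (by ring)
    have heq : (1 - 1 / ((n : ℝ) + 1)) • Z
        + (1 / ((n : ℝ) + 1)) • (Z + ((n : ℝ) + 1) • (Y n - Z)) = Y n := by
      match_scalars <;> field_simp; ring
    rw [heq, smul_eq_mul, smul_eq_mul] at hconvn
    refine hconvn.trans ?_
    gcongr
    exact hM' _ (hadd n)

variable {Ω : Type*} [MeasurableSpace Ω] {P : Measure Ω} {Φ : ℝ≥0 → ℝ≥0}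

theorem mem_Icc_of_ae_abs_le {𝒳 : Submodule ℝ (Ω →ₘ[P] ℝ)} (Z : 𝒳) {V U : 𝒳}
    (h : ∀ᵐ ω ∂P, |(V : Ω →ₘ[P] ℝ) ω| ≤ (U : Ω →ₘ[P] ℝ) ω) :
    Z + V ∈ Set.Icc (Z - U) (Z + U) ∧ Z - V ∈ Set.Icc (Z - U) (Z + U) := by
  have hle : ∀ S T : 𝒳, (S : Ω →ₘ[P] ℝ) ≤ᵐ[P] (T : Ω →ₘ[P] ℝ) → S ≤ T := fun S T hST =>
    (AEEqFun.coeFn_le (f := (S : Ω →ₘ[P] ℝ)) (g := (T : Ω →ₘ[P] ℝ))).1 hST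
  have haU := AEEqFun.coeFn_add (Z : Ω →ₘ[P] ℝ) (U : Ω →ₘ[P] ℝ)
  have haV := AEEqFun.coeFn_add (Z : Ω →ₘ[P] ℝ) (V : Ω →ₘ[P] ℝ)
  have hsU := AEEqFun.coeFn_sub (Z : Ω →ₘ[P] ℝ) (U : Ω →ₘ[P] ℝ)
  have hsV := AEEqFun.coeFn_sub (Z : Ω →ₘ[P] ℝ) (V : Ω →ₘ[P] ℝ)
  refine ⟨⟨hle _ _ ?_, hle _ _ ?_⟩, ⟨hle _ _ ?_, hle _ _ ?_⟩⟩ <;>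
  · simp only [Submodule.coe_add, Submodule.coe_sub]
    filter_upwards [h, haU, haV, hsU, hsV] with ω h h1 h2 h3 h4
    simp only [h1, h2, h3, h4, Pi.add_apply, Pi.sub_apply]
    linarith [abs_le.1 h]

/-- A sequence of the Orlicz heart whose modulars decrease fast enough converges relatively
uniformly to zero. -/
theorem exists_mem_orliczHeart_bound (hΦ : IsOrliczFunction Φ) (W : ℕ → orliczHeart hΦ P)
    (hW : ∀ k : ℕ, ∫⁻ ω, (Φ (((k : ℝ≥0) + 1) * ((k : ℝ≥0) + 1) * ‖(W k : Ω →ₘ[P] ℝ) ω‖₊) : ℝ≥0∞) ∂P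
      ≤ 2⁻¹ ^ k) :
    ∃ U : orliczHeart hΦ P, ∀ k : ℕ, ∀ᵐ ω ∂P,
      ((k : ℝ) + 1) * |(W k : Ω →ₘ[P] ℝ) ω| ≤ (U : Ω →ₘ[P] ℝ) ω := by
  let w : ℕ → Ω → ℝ≥0 := fun k ω => ((k : ℝ≥0) + 1) * ‖(W k : Ω →ₘ[P] ℝ) ω‖₊
  have hwm : ∀ k, Measurable (w k) := fun k =>
    ((W k : Ω →ₘ[P] ℝ).stronglyMeasurable.measurable.nnnorm).const_mul _
  have hm : ∀ (c : ℝ≥0) k, Measurable fun ω => (Φ (c * w k ω) : ℝ≥0∞) := fun c k =>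
    (hΦ.increasing.measurable.comp ((hwm k).const_mul c)).coe_nnreal_ennreal
  have hsum : ∀ c : ℝ≥0, 0 < c → ∫⁻ ω, ∑' k, (Φ (c * w k ω) : ℝ≥0∞) ∂P < ∞ := by
    intro c hc
    -- For `k ≥ N ≥ c` the scaling `c(k+1)` is at most `(k+1)²`, so the geometric bound applies; the
    -- finitely many other terms are finite by membership in the heart.
    obtain ⟨N, hN⟩ := exists_nat_ge c
    rw [lintegral_tsum fun k => (hm c k).aemeasurable]
    have hterm : ∀ k, ∫⁻ ω, (Φ (c * w k ω) : ℝ≥0∞) ∂P ≠ ∞ := by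
      intro k
      have := (W k).2 (c * ((k : ℝ≥0) + 1)) (by positivity)
      simp only [w, ← mul_assoc]
      exact this.ne
    have hle : ∀ k, ∫⁻ ω, (Φ (c * w k ω) : ℝ≥0∞) ∂P
        ≤ (if k ∈ Finset.range N then ∫⁻ ω, (Φ (c * w k ω) : ℝ≥0∞) ∂P else 0) + 2⁻¹ ^ k := by
      intro k
      split_ifs with hk
      · exact le_self_add
      · rw [zero_add]
        refine (lintegral_mono fun ω => ?_).trans (hW k)
        rw [ENNReal.coe_le_coe]
        refine hΦ.increasing ?_
        simp only [w, ← mul_assoc]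
        gcongr
        have : (N : ℝ≥0) ≤ k := by simpa using hk
        exact hN.trans (this.trans le_self_add)
    refine (ENNReal.tsum_le_tsum hle).trans_lt ?_
    rw [ENNReal.tsum_add, ENNReal.tsum_geometric, tsum_eq_sum (s := Finset.range N)
      fun k hk => if_neg hk]
    refine ENNReal.add_lt_top.2 ⟨ENNReal.sum_lt_top.2 fun k hk => ?_, by simp⟩
    rw [if_pos hk]
    exact (hterm k).lt_top
  have hbdd : ∀ᵐ ω ∂P, BddAbove (Set.range fun k => w k ω) := by
    filter_upwards [ae_lt_top (Measurable.tsum fun k => hm 1 k) (hsum 1 one_pos).ne]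
      with ω hω
    obtain ⟨x, hx⟩ := hΦ.exists_lt (∑' k, (Φ (1 * w k ω) : ℝ≥0∞)).toNNReal
    refine ⟨x, ?_⟩
    rintro _ ⟨k, rfl⟩
    by_contra! hlt
    have h1 : (Φ (1 * w k ω) : ℝ≥0∞) ≤ ∑' k, (Φ (1 * w k ω) : ℝ≥0∞) :=
      ENNReal.le_tsum k
    rw [← ENNReal.coe_toNNReal hω.ne, ENNReal.coe_le_coe, one_mul] at h1
    exact absurd ((hΦ.increasing hlt.le).trans h1) hx.not_ge
  let u : Ω → ℝ≥0 := fun ω => ⨆ k, w k ω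
  have hum : Measurable u := Measurable.iSup hwm
  have hum' : AEStronglyMeasurable (fun ω => (u ω : ℝ)) P :=
    hum.coe_nnreal_real.aestronglyMeasurable
  have hu : ∀ c : ℝ≥0, 0 < c → ∫⁻ ω, (Φ (c * ‖(u ω : ℝ)‖₊) : ℝ≥0∞) ∂P < ∞ := by
    intro c hc
    -- The supremum need not be attained, but some `w k ω` exceeds half of it, whence the factor
    -- `2`. Where the family is unbounded, `u` has the default value `0`.
    refine (lintegral_mono fun ω => ?_).trans_lt (hsum (2 * c) (by positivity))
    rw [NNReal.nnnorm_eq]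
    rcases eq_or_ne (u ω) 0 with h0 | h0
    · simp [h0, hΦ.map_zero]
    · obtain ⟨k, hk⟩ := exists_lt_of_lt_ciSup (NNReal.half_lt_self h0)
      refine le_trans ?_ (ENNReal.le_tsum k)
      rw [ENNReal.coe_le_coe]
      refine hΦ.increasing ?_
      calc c * u ω = 2 * c * (u ω / 2) := by field_simp
        _ ≤ _ := by gcongr
  refine ⟨⟨_, mk_mem_orliczHeart hΦ hum' hu⟩, fun k => ?_⟩
  filter_upwards [hbdd, AEEqFun.coeFn_mk _ hum'] with ω hω hmk
  rw [hmk]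
  exact NNReal.coe_le_coe.2 (le_ciSup hω k)

/-- A convex functional on the Orlicz heart that is order bounded above is sequentially continuous
with respect to modular convergence. -/
theorem ConvexOn.tendsto_of_tendsto_modular (hΦ : IsOrliczFunction Φ) {ρ : orliczHeart hΦ P → ℝ}
    (hconv : ConvexOn ℝ Set.univ ρ) (hbdd : OrderBoundedAbove ρ) {Y : ℕ → orliczHeart hΦ P}
    {Z : orliczHeart hΦ P}
    (hYZ : ∀ k : ℕ, Tendsto (fun n => ∫⁻ ω, (Φ (((k : ℝ≥0) + 1) *
      ‖(Y n : Ω →ₘ[P] ℝ) ω - (Z : Ω →ₘ[P] ℝ) ω‖₊) : ℝ≥0∞) ∂P) atTop (𝓝 0)) :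
    Tendsto (fun n => ρ (Y n)) atTop (𝓝 (ρ Z)) := by
  refine tendsto_of_subseq_tendsto fun ns hns => ?_
  have hex : ∀ k : ℕ, ∃ m, ∫⁻ ω, (Φ (((k : ℝ≥0) + 1) * ((k : ℝ≥0) + 1) *
      ‖((Y (ns m) - Z : orliczHeart hΦ P) : Ω →ₘ[P] ℝ) ω‖₊) : ℝ≥0∞) ∂P ≤ 2⁻¹ ^ k := by
    intro k
    -- The index is chosen because `k² + 2k + 1 = (k+1)²`.
    have h1 := (hYZ (k * k + 2 * k)).comp hns
    have hpos : (0 : ℝ≥0∞) < 2⁻¹ ^ k := by simp [pos_iff_ne_zero]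
    obtain ⟨m, hm⟩ := (h1.eventually_le_const hpos).exists
    refine ⟨m, le_trans (le_of_eq (lintegral_congr_ae ?_)) hm⟩
    filter_upwards [AEEqFun.coeFn_sub (Y (ns m) : Ω →ₘ[P] ℝ) (Z : Ω →ₘ[P] ℝ)] with ω hω
    rw [Submodule.coe_sub, hω, Pi.sub_apply]
    congr 3
    push_cast
    ring
  choose ms hms using hex
  obtain ⟨U, hU⟩ := exists_mem_orliczHeart_bound hΦ (fun k => Y (ns (ms k)) - Z) hms
  have hcoe : ∀ k : ℕ, ∀ᵐ ω ∂P, |((((k : ℝ) + 1) • (Y (ns (ms k)) - Z) :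
      orliczHeart hΦ P) : Ω →ₘ[P] ℝ) ω| ≤ (U : Ω →ₘ[P] ℝ) ω := by
    intro k
    filter_upwards [hU k, AEEqFun.coeFn_smul ((k : ℝ) + 1)
      ((Y (ns (ms k)) - Z : orliczHeart hΦ P) : Ω →ₘ[P] ℝ)] with ω h1 h2
    rw [Submodule.coe_smul, h2, Pi.smul_apply, smul_eq_mul, abs_mul,
      abs_of_pos (by positivity : (0 : ℝ) < (k : ℝ) + 1)]
    exact h1
  exact ⟨ms, hconv.tendsto_of_relatively_uniform hbdd
    (fun k => (mem_Icc_of_ae_abs_le Z (hcoe k)).1) fun k => (mem_Icc_of_ae_abs_le Z (hcoe k)).2⟩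

end Continuity

/-! ### Empirical distribution functions and modulars -/

section EmpiricalMeasures

variable {Ω : Type*} {ξ : ℕ → Ω → ℝ}

theorem isProbabilityMeasure_empiricalMeasure (ξ : ℕ → Ω → ℝ) (n : ℕ) (ω : Ω) :
    IsProbabilityMeasure (empiricalMeasure ξ (n + 1) ω) := by
  refine ⟨?_⟩
  have h : ((n + 1 : ℕ) : ℝ≥0∞) ≠ 0 := by simp
  simpa [empiricalMeasure] using ENNReal.inv_mul_cancel h (ENNReal.natCast_ne_top _)

theorem lintegral_empiricalMeasure (n : ℕ) (ω : Ω) {g : ℝ → ℝ≥0} (hg : Measurable g) :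
    ∫⁻ x, (g x : ℝ≥0∞) ∂(empiricalMeasure ξ (n + 1) ω)
      = ENNReal.ofReal ((∑ i ∈ Finset.range (n + 1), (g (ξ i ω) : ℝ)) / (n + 1 : ℕ)) := by
  rw [empiricalMeasure, lintegral_smul_measure, lintegral_finsetSum_measure]
  simp_rw [lintegral_dirac' _ hg.coe_nnreal_ennreal]
  rw [ENNReal.ofReal_div_of_pos (by positivity), ENNReal.ofReal_natCast,
    ENNReal.ofReal_sum_of_nonneg fun _ _ => NNReal.coe_nonneg _, smul_eq_mul, mul_comm,
    div_eq_mul_inv]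
  simp_rw [ENNReal.ofReal_coe_nnreal]

theorem cdf_empiricalMeasure (n : ℕ) (ω : Ω) (r : ℝ) :
    ProbabilityTheory.cdf (empiricalMeasure ξ (n + 1) ω) r
      = (∑ i ∈ Finset.range (n + 1), (Set.Iic r).indicator (fun _ => (1 : ℝ)) (ξ i ω))
        / (n + 1 : ℕ) := by
  have := isProbabilityMeasure_empiricalMeasure ξ n ω
  have h := lintegral_empiricalMeasure (ξ := ξ) n ω (g := (Set.Iic r).indicator fun _ => 1)
    (measurable_const.indicator measurableSet_Iic)
  have h1 : ∀ x, (((Set.Iic r).indicator (fun _ => 1) x : ℝ≥0) : ℝ≥0∞)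
      = (Set.Iic r).indicator (fun _ => 1) x := fun x => by
    by_cases hx : x ∈ Set.Iic r <;> simp [hx]
  have h2 : ∀ x, (((Set.Iic r).indicator (fun _ => 1) x : ℝ≥0) : ℝ)
      = (Set.Iic r).indicator (fun _ => 1) x := fun x => by
    by_cases hx : x ∈ Set.Iic r <;> simp [hx]
  simp_rw [h1, h2] at h
  rw [lintegral_indicator_const measurableSet_Iic, one_mul] at h
  rw [ProbabilityTheory.cdf_eq_real, measureReal_def, h, ENNReal.toReal_ofReal]
  exact div_nonneg (Finset.sum_nonneg fun i _ => Set.indicator_nonneg (fun _ _ => zero_le_one) _)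
    (Nat.cast_nonneg _)

variable [MeasurableSpace Ω] {P : Measure Ω} [IsProbabilityMeasure P]

theorem IsErgodicSeq.ae_tendsto_cdf (hm : ∀ n, Measurable (ξ n)) (hs : IsStationarySeq P ξ)
    (he : IsErgodicSeq P ξ) (r : ℝ) :
    ∀ᵐ ω ∂P, Tendsto (fun n => ProbabilityTheory.cdf (empiricalMeasure ξ (n + 1) ω) r) atTop
      (𝓝 (ProbabilityTheory.cdf (P.map (ξ 0)) r)) := by
  have : IsProbabilityMeasure (P.map (ξ 0)) :=
    Measure.isProbabilityMeasure_map (hm 0).aemeasurable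
  have hgi : Integrable ((Set.Iic r).indicator fun _ => (1 : ℝ)) (P.map (ξ 0)) :=
    (integrable_const 1).indicator measurableSet_Iic
  filter_upwards [he.ae_tendsto_sum_div hm hs (measurable_const.indicator measurableSet_Iic) hgi]
    with ω hω
  rw [integral_indicator_const _ measurableSet_Iic, smul_eq_mul, mul_one,
    ← ProbabilityTheory.cdf_eq_real] at hω
  simp_rw [cdf_empiricalMeasure]
  exact hω.comp (tendsto_add_atTop_nat 1)

theorem IsErgodicSeq.ae_tendsto_lintegral (hm : ∀ n, Measurable (ξ n)) (hs : IsStationarySeq P ξ)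
    (he : IsErgodicSeq P ξ) {g : ℝ → ℝ≥0} (hg : Measurable g)
    (hgi : ∫⁻ x, (g x : ℝ≥0∞) ∂(P.map (ξ 0)) ≠ ∞) :
    ∀ᵐ ω ∂P, Tendsto (fun n => ∫⁻ x, (g x : ℝ≥0∞) ∂(empiricalMeasure ξ (n + 1) ω)) atTop
      (𝓝 (∫⁻ x, (g x : ℝ≥0∞) ∂(P.map (ξ 0)))) := by
  have hi : Integrable (fun x => (g x : ℝ)) (P.map (ξ 0)) := by
    refine ⟨hg.coe_nnreal_real.aestronglyMeasurable, ?_⟩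
    rw [hasFiniteIntegral_iff_ofReal (ae_of_all _ fun x => (g x).coe_nonneg)]
    simpa using hgi.lt_top
  filter_upwards [he.ae_tendsto_sum_div hm hs hg.coe_nnreal_real hi] with ω hω
  simp_rw [lintegral_empiricalMeasure _ _ hg]
  have h1 := (ENNReal.continuous_ofReal.tendsto _).comp (hω.comp (tendsto_add_atTop_nat 1))
  rw [ofReal_integral_eq_lintegral_ofReal hi (ae_of_all _ fun x => (g x).coe_nonneg)] at h1
  simpa [Function.comp_def] using h1

end EmpiricalMeasures

/-! ### Coupling distributions through one uniform variable -/

section QuantileCoupling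

variable {Ω : Type*} [MeasurableSpace Ω] {P : Measure Ω} {U : Ω → ℝ} {ν : Measure ℝ}
  {Φ : ℝ≥0 → ℝ≥0}

theorem aemeasurable_lowerQuantile_comp (hU : Measurable U)
    (hUlaw : P.map U = volume.restrict (Set.Ioo 0 1)) (ν : Measure ℝ) :
    AEMeasurable (fun ω => lowerQuantile ν (U ω)) P := by
  have h := aemeasurable_lowerQuantile ν
  rw [← hUlaw] at h
  exact h.comp_measurable hU

theorem map_lowerQuantile_comp (hU : Measurable U)
    (hUlaw : P.map U = volume.restrict (Set.Ioo 0 1)) (ν : Measure ℝ) [IsProbabilityMeasure ν] :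
    P.map (fun ω => lowerQuantile ν (U ω)) = ν := by
  have h := aemeasurable_lowerQuantile ν
  rw [← hUlaw] at h
  have h2 := AEMeasurable.map_map_of_aemeasurable h hU.aemeasurable
  rw [hUlaw, map_lowerQuantile] at h2
  exact h2.symm

theorem lintegral_modular_lowerQuantile_comp (hΦ : IsOrliczFunction Φ) (hU : Measurable U)
    (hUlaw : P.map U = volume.restrict (Set.Ioo 0 1)) (ν : Measure ℝ) [IsProbabilityMeasure ν]
    (c : ℝ≥0) :
    ∫⁻ ω, (Φ (c * ‖lowerQuantile ν (U ω)‖₊) : ℝ≥0∞) ∂P = ∫⁻ x, (Φ (c * ‖x‖₊) : ℝ≥0∞) ∂ν := by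
  conv_rhs => rw [← map_lowerQuantile_comp hU hUlaw ν]
  exact (lintegral_map' (hΦ.measurable_modular c).aemeasurable
    (aemeasurable_lowerQuantile_comp hU hUlaw ν)).symm

/-- Every distribution with finite modulars is the distribution of an element of the Orlicz heart,
namely of its quantile function evaluated at a uniform random variable. -/
theorem exists_mem_orliczHeart_lawOf_eq (hΦ : IsOrliczFunction Φ) (hU : Measurable U)
    (hUlaw : P.map U = volume.restrict (Set.Ioo 0 1)) (ν : Measure ℝ) [IsProbabilityMeasure ν]
    (h : ∀ c : ℝ≥0, 0 < c → ∫⁻ x, (Φ (c * ‖x‖₊) : ℝ≥0∞) ∂ν < ∞) :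
    ∃ Y : orliczHeart hΦ P, (Y : Ω →ₘ[P] ℝ) =ᵐ[P] (fun ω => lowerQuantile ν (U ω)) ∧
      lawOf (Y : Ω →ₘ[P] ℝ) = ν := by
  have hq := (aemeasurable_lowerQuantile_comp hU hUlaw ν).aestronglyMeasurable
  refine ⟨⟨AEEqFun.mk _ hq, mk_mem_orliczHeart hΦ hq fun c hc => ?_⟩, AEEqFun.coeFn_mk _ hq, ?_⟩
  · rw [lintegral_modular_lowerQuantile_comp hΦ hU hUlaw]
    exact h c hc
  · rw [lawOf, Measure.map_congr (AEEqFun.coeFn_mk _ hq), map_lowerQuantile_comp hU hUlaw]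

end QuantileCoupling

/-! ### Strong consistency -/

theorem mainTheorem2 {Ω : Type*} [MeasurableSpace Ω] (P : Measure Ω) [IsProbabilityMeasure P]
    (hP : IsNonatomic P) {Φ : ℝ≥0 → ℝ≥0} (hΦ : IsOrliczFunction Φ)
    (ρ : orliczHeart hΦ P → ℝ) (hconv : ConvexOn ℝ Set.univ ρ)
    (hlaw : LawInvariant ρ) (hbdd : OrderBoundedAbove ρ) :
    ∀ X : orliczHeart hΦ P, StronglyConsistentAt ρ X := by
  intro X ξ hm hs he hξX
  obtain ⟨U, hU, hUlaw⟩ := hP.exists_uniform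
  have hemp := fun n ω => isProbabilityMeasure_empiricalMeasure ξ n ω
  have hXm : AEMeasurable (X : Ω →ₘ[P] ℝ) P :=
    (X : Ω →ₘ[P] ℝ).stronglyMeasurable.measurable.aemeasurable
  have : IsProbabilityMeasure (P.map (X : Ω →ₘ[P] ℝ)) := Measure.isProbabilityMeasure_map hXm
  have hlawX : P.map (ξ 0) = P.map (X : Ω →ₘ[P] ℝ) := hξX 0
  have hmodX : ∀ c : ℝ≥0, 0 < c →
      ∫⁻ x, (Φ (c * ‖x‖₊) : ℝ≥0∞) ∂(P.map (X : Ω →ₘ[P] ℝ)) < ∞ := by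
    intro c hc
    rw [lintegral_map' (hΦ.measurable_modular c).aemeasurable hXm]
    exact X.2 c hc
  have hg : ∀ c : ℝ≥0, Measurable fun x : ℝ => Φ (c * ‖x‖₊) := fun c =>
    hΦ.increasing.measurable.comp (measurable_nnnorm.const_mul c)
  -- `X` need not be a function of `U`; its quantile version `Z` replaces it by law invariance.
  obtain ⟨Z, hZae, hZlaw⟩ := exists_mem_orliczHeart_lawOf_eq hΦ hU hUlaw _ hmodX
  have hY := fun n ω => exists_mem_orliczHeart_lawOf_eq hΦ hU hUlaw (empiricalMeasure ξ (n + 1) ω)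
    fun c _ => by rw [lintegral_empiricalMeasure n ω (hg c)]; exact ENNReal.ofReal_lt_top
  choose Y hYae hYlaw using hY
  refine ⟨fun n ω => ⟨Y n ω, hYlaw n ω⟩, ?_⟩
  have hcdf := ae_all_iff.2 fun r : ℚ => he.ae_tendsto_cdf hm hs r
  -- The factor `2` anticipates the doubling in the modular estimate for differences.
  have hmod := ae_all_iff.2 fun k : ℕ =>
    he.ae_tendsto_lintegral hm hs (hg (2 * ((k : ℝ≥0) + 1)))
      (by rw [hlawX]; exact (hmodX _ (by positivity)).ne)
  rw [hlawX] at hcdf hmod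
  filter_upwards [hcdf, hmod] with ω hω1 hω2
  have hρ : ∀ n, inducedMap ρ ⟨empiricalMeasure ξ (n + 1) ω, Y n ω, hYlaw n ω⟩ = ρ (Y n ω) :=
    fun n => hlaw _ _ ((Exists.choose_spec (p := fun W : orliczHeart hΦ P =>
      lawOf (W : Ω →ₘ[P] ℝ) = empiricalMeasure ξ (n + 1) ω) ⟨Y n ω, hYlaw n ω⟩).trans
      (hYlaw n ω).symm)
  simp_rw [hρ]
  rw [hlaw X Z hZlaw.symm]
  refine hconv.tendsto_of_tendsto_modular hΦ hbdd fun k => ?_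
  -- The sample point `ω` is now fixed; the coupling lives in the separate variable `η`.
  have hq : ∀ᵐ η ∂P, Tendsto (fun n => lowerQuantile (empiricalMeasure ξ (n + 1) ω) (U η)) atTop
      (𝓝 (lowerQuantile (P.map (X : Ω →ₘ[P] ℝ)) (U η))) := by
    have h := ae_tendsto_lowerQuantile hω1
    rw [← hUlaw] at h
    exact ae_of_ae_map hU.aemeasurable h
  have key := hΦ.tendsto_modular_sub
    (fun n => aemeasurable_lowerQuantile_comp hU hUlaw (empiricalMeasure ξ (n + 1) ω))
    (aemeasurable_lowerQuantile_comp hU hUlaw (P.map (X : Ω →ₘ[P] ℝ))) hq ((k : ℝ≥0) + 1)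
    (by
      rw [lintegral_modular_lowerQuantile_comp hΦ hU hUlaw]
      exact (hmodX _ (by positivity)).ne)
    (by
      simp_rw [lintegral_modular_lowerQuantile_comp hΦ hU hUlaw]
      exact hω2 k)
  refine key.congr fun n => lintegral_congr_ae ?_
  filter_upwards [hYae n ω, hZae] with η h1 h2
  rw [h1, h2]
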